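/- Let $d,m,N$ be natural numbers, $\mathbb T^d=(\mathbb R/\mathbb Z)^d$, and let $V:(\mathbb T^d)^m\to\mathbb R$ be continuous. Put $$\mathcal H=-\tfrac12\sum_{n=1}^m\Delta_{x_n}+V(x_1,\dots,x_m),$$ and let $e^{-i\mathcal Ht}$, $t\in\mathbb R$, denote the strongly continuous one-parameter unitary group on $L^2(\mathbb T^{md})$ generated by $-i\mathcal H$, i.e. the one with $\frac{d}{dt}\big|_{t=0}e^{-i\mathcal Ht}f=-i\mathcal Hf$ in $L^2$ for all $f\in C^2(\mathbb T^{md})$; exactly one such group exists. For $i_*\in\{0,1\}^m$ and $x_{*0}=(x_{10},\dots,x_{m0})$, $x_{*1}=(x_{11},\dots,x_{m1})\in(\mathbb T^d)^m$ write $x_{*i_*}=(x_{1i_1},\dots,x_{mi_m})$ and $x_{*(1-i_*)}=(x_{1(1-i_1)},\dots,x_{m(1-i_m)})$. For $\Psi=(\Psi_1,\dots,\Psi_N)$ let $\Psi_c=\frac1N\sum_k\Psi_k$, and for real coupling strengths $\kappa_{i_*}$ put $$R_j(\Psi)(x_{*0})=i\sum_{i_*\in\{0,1\}^m}\kappa_{i_*}\int_{\mathbb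 T^{md}}\Big(\Psi_c(x_{*i_*})\overline{\Psi_j(x_{*1})}\Psi_j(x_{*(1-i_*)})-\Psi_j(x_{*i_*})\overline{\Psi_c(x_{*1})}\Psi_j(x_{*(1-i_*)})\Big)dx_{*1}.$$ "Global smooth solution" below means a family of functions on $[0,\infty)\times\mathbb T^{md}$ satisfying the equation pointwise for $t>0$ and the initial condition at $t=0$; it is enough that each function is continuous on $[0,\infty)\times\mathbb T^{md}$ and, for $t>0$, differentiable in $t$ with jointly continuous $t$-derivative and $C^2$ in $x$. (SLT model.) Suppose that $V$ is additive, $V(x_1,\dots,x_m)=\sum_{n=1}^mV_n(x_n)$. Let $\{\Psi_j\}$ and $\{\varphi_j\}$ be global smooth solutions of $$i\partial_t\Psi_j-\mathcal H\Psi_j=R_j(\Psi),\qquad i\partial_t\varphi_j=R_j(\varphi),\qquad j=1,\dots,N,$$ respectively, with the same initial data $\Psi_j|_{t=0}=\varphi_j|_{t=0}=\Psi_j^{in}$. Then $$\Psi_j(t)=e^{-i\mathcal Ht}\varphi_j(t)\quad\text{in }L^2(\mathbb T^{md}),\qquad t\ge0,\ j=1,\dots,N.$$ (SLM model.) Let $m=2$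 and $V(x_1,x_2)=V_1(x_1)+V_2(x_2)$. The same conclusion holds if, for real $\kappa_0,\kappa_1$, $R_j(\Psi)(x_1,x_2)$ is replaced by $$\begin{aligned}&i\kappa_0\int_{\mathbb T^{2d}}\Big(\Psi_c(x_1,x_2^*)\overline{\Psi_j(x_1^*,x_2^*)}\Psi_j(x_1^*,x_2)-\Psi_j(x_1,x_2^*)\overline{\Psi_c(x_1^*,x_2^*)}\Psi_j(x_1^*,x_2)\Big)dx_1^*dx_2^*\\&+i\kappa_1\int_{\mathbb T^{2d}}\Big(\Psi_j(x_1,x_2^*)\overline{\Psi_j(x_1^*,x_2^*)}\Psi_c(x_1^*,x_2)-\Psi_j(x_1,x_2^*)\overline{\Psi_c(x_1^*,x_2^*)}\Psi_j(x_1^*,x_2)\Big)dx_1^*dx_2^*\end{aligned}$$ in both systems. -/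

import Mathlib

open MeasureTheory
open scoped ComplexConjugate

noncomputable section

/-- The flat torus `𝕋^d = (ℝ/ℤ)^d`. -/
abbrev Torus (d : ℕ) : Type := Fin d → UnitAddCircle

/-- The configuration space `(𝕋^d)^m`; a point is `x = (x_1, …, x_m)` with `x_n ∈ 𝕋^d`. -/
abbrev Config (m d : ℕ) : Type := Fin m → Torus d

/-- The complex Hilbert space `L²(𝕋^{md})`. -/
abbrev L2 (m d : ℕ) : Type := Lp ℂ 2 (volume : Measure (Config m d))

open Classical in
/-- The class in `L²(𝕋^{md})` of a square-integrable function (for instance a continuous one);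
by convention `0` for a function that is not square-integrable. -/
def toL2 {m d : ℕ} (f : Config m d → ℂ) : L2 m d :=
  if h : MemLp f 2 (volume : Measure (Config m d)) then h.toLp f else 0

/-- A function on the torus is `C²` if its periodic lift to `ℝ^{md}` is `C²`. -/
def IsC2 {m d : ℕ} (f : Config m d → ℂ) : Prop :=
  ContDiff ℝ 2 (fun y : Fin m → Fin d → ℝ => f (fun n a => (y n a : UnitAddCircle)))

/-- The Laplacian `Δ_{x_n}` in the `n`-th variable `x_n ∈ 𝕋^d`: the sum over the `d` coordinate
directions `a` of the second derivative of `f` in that direction. -/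
def laplacianIn {m d : ℕ} (n : Fin m) (f : Config m d → ℂ) (x : Config m d) : ℂ :=
  ∑ a : Fin d,
    iteratedDeriv 2 (fun s : ℝ => f (x + Pi.single n (Pi.single a (s : UnitAddCircle)))) 0

/-- The Hamiltonian `H = -½ ∑_n Δ_{x_n} + V(x_1, …, x_m)`, acting on `C²` functions. -/
def hamiltonian {m d : ℕ} (V : Config m d → ℝ) (f : Config m d → ℂ) (x : Config m d) : ℂ :=
  -(1 / 2 : ℂ) * ∑ n : Fin m, laplacianIn n f x + (V x : ℂ) * f x

/-- `U` is a strongly continuous one-parameter group of linear isometries (hence of unitary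
operators) on `L²(𝕋^{md})` that is generated by `-iH`: on every `C²` function `f`, the derivative
of `t ↦ U(t) f` at `t = 0` in `L²` is `-i H f`. -/
structure IsSchrodingerGroup {m d : ℕ} (V : Config m d → ℝ)
    (U : ℝ → L2 m d →L[ℂ] L2 m d) : Prop where
  norm_map : ∀ (t : ℝ) (F : L2 m d), ‖U t F‖ = ‖F‖
  zero : U 0 = ContinuousLinearMap.id ℂ (L2 m d)
  add : ∀ s t : ℝ, U (s + t) = (U s).comp (U t)
  continuous : ∀ F : L2 m d, Continuous (fun t : ℝ => U t F)
  generator : ∀ f : Config m d → ℂ, IsC2 f →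
    HasDerivAt (fun t : ℝ => U t (toL2 f)) (-Complex.I • toL2 (hamiltonian V f)) 0

/-- The unitary group `t ↦ e^{-iHt}` on `L²(𝕋^{md})`: the group generated by `-iH`.
(That exactly one such group exists is part of the theorem.) -/
def schrodingerGroup {m d : ℕ} (V : Config m d → ℝ) : ℝ → L2 m d →L[ℂ] L2 m d :=
  Classical.epsilon (IsSchrodingerGroup V)

/-- The average `Ψ_c = (1/N) ∑_k Ψ_k`. -/
def meanState {m d N : ℕ} (Ψ : Fin N → Config m d → ℂ) (x : Config m d) : ℂ :=
  (1 / (N : ℂ)) * ∑ k : Fin N, Ψ k x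

/-- For two points `x = x_{*0}` and `y = x_{*1}` and a multi-index `i_* ∈ {0,1}^m`, the point
`x_{*i_*}`, whose `n`-th component is `x_n` if `i_n = 0` and `y_n` if `i_n = 1`. -/
def pick {m d : ℕ} (i : Fin m → Fin 2) (x y : Config m d) : Config m d :=
  fun n => if i n = 0 then x n else y n

/-- The right-hand side of the Schrödinger–Lohe tensor model:
`i ∑_{i_*} κ_{i_*} ∫ (Ψ_c(x_{*i_*}) conj(Ψ_j(x_{*1})) Ψ_j(x_{*(1-i_*)})
  - Ψ_j(x_{*i_*}) conj(Ψ_c(x_{*1})) Ψ_j(x_{*(1-i_*)})) dx_{*1}` at `x = x_{*0}`. -/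
def sltInteraction {m d N : ℕ} (κ : (Fin m → Fin 2) → ℝ) (Ψ : Fin N → Config m d → ℂ)
    (j : Fin N) (x : Config m d) : ℂ :=
  Complex.I * ∑ i : Fin m → Fin 2, (κ i : ℂ) * ∫ y : Config m d,
    (meanState Ψ (pick i x y) * conj (Ψ j y) * Ψ j (pick (fun n => 1 - i n) x y)
      - Ψ j (pick i x y) * conj (meanState Ψ y) * Ψ j (pick (fun n => 1 - i n) x y))

/-- The right-hand side of the Schrödinger–Lohe matrix model; here `x = (x_1, x_2)` and
`y = (x_1^*, x_2^*)`. -/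
def slmInteraction {d N : ℕ} (κ₀ κ₁ : ℝ) (Ψ : Fin N → Config 2 d → ℂ)
    (j : Fin N) (x : Config 2 d) : ℂ :=
  Complex.I * (κ₀ : ℂ) * (∫ y : Config 2 d,
      (meanState Ψ ![x 0, y 1] * conj (Ψ j y) * Ψ j ![y 0, x 1]
        - Ψ j ![x 0, y 1] * conj (meanState Ψ y) * Ψ j ![y 0, x 1]))
  + Complex.I * (κ₁ : ℂ) * (∫ y : Config 2 d,
      (Ψ j ![x 0, y 1] * conj (Ψ j y) * meanState Ψ ![y 0, x 1]
        - Ψ j ![x 0, y 1] * conj (meanState Ψ y) * Ψ j ![y 0, x 1]))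

/-- `Ψ = (Ψ_1, …, Ψ_N)` is a global classical solution of the Cauchy problem
`i ∂_t Ψ_j - A Ψ_j = R(Ψ)_j` for `t > 0`, `Ψ_j = Ψ_j^in` at `t = 0`: every `Ψ_j` is continuous on
`[0,∞) × 𝕋^{md}`, continuously differentiable in time and `C²` in space for `t > 0`, and the
equation holds pointwise. In particular every solution that is smooth on `[0,∞) × 𝕋^{md}` is a
classical one. -/
structure IsGlobalSolution {m d N : ℕ} (A : (Config m d → ℂ) → Config m d → ℂ)
    (R : (Fin N → Config m d → ℂ) → Fin N → Config m d → ℂ)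
    (Ψin : Fin N → Config m d → ℂ) (Ψ : Fin N → ℝ → Config m d → ℂ) : Prop where
  continuousOn : ∀ j, ContinuousOn (fun p : ℝ × Config m d => Ψ j p.1 p.2)
    (Set.Ici 0 ×ˢ Set.univ)
  differentiableAt : ∀ j, ∀ t : ℝ, 0 < t → ∀ x, DifferentiableAt ℝ (fun s => Ψ j s x) t
  continuousOn_deriv : ∀ j, ContinuousOn
    (fun p : ℝ × Config m d => deriv (fun s => Ψ j s p.2) p.1) (Set.Ioi 0 ×ˢ Set.univ)
  space : ∀ j, ∀ t : ℝ, 0 < t → IsC2 (Ψ j t)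
  equation : ∀ j, ∀ t : ℝ, 0 < t → ∀ x,
    Complex.I * deriv (fun s => Ψ j s x) t - A (Ψ j t) x = R (fun k => Ψ k t) j x
  initial : ∀ j x, Ψ j 0 x = Ψin j x

end

/-! Both interactions are combinations of cubic terms `tripleProduct i f g h`, whose pairing with
`e` is ⟨e ⊗ g, S_i (f ⊗ h)⟩ on the doubled torus, where the unitary S_i swaps the components of x
and y selected by i. An additive Hamiltonian is a sum of one-component operators, so H ⊗ 1 + 1 ⊗ H
does not see which copy a component belongs to and commutes with S_i. Hence U(t) = e^{-iHt}
satisfies U(t) T_i(f, g, h) = T_i(U(t) f, U(t) g, U(t) h) (`torusGroup_tripleProduct`), and the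
whole interaction commutes with U(t). Then U(-t) Ψ(t) loses the linear term, solves the same
equation as φ with the same data, and equals φ because the cubic interaction is Lipschitz on balls
of L² (`LipschitzOnBalls.ode_unique`).

Unbounded operators are avoided throughout. The free group D(t) is diagonal in the Fourier basis;
the bounded potential is added in the interaction picture, where the equation has bounded strongly
continuous skew coefficients: a Dyson series solves it and conservation of the norm gives
uniqueness. The generator is only ever applied to C² functions: characters for uniqueness of the
group (`eq_perturbedGroup`), and Ψ(t) with t > 0 for the conjugation.

The commutation with S_i splits in the same way. For D(t) it is checked on characters, whose energy
is additive over components (`exchangeForm_diagGroup`). For the potential it is the pointwise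
identity `ExchangeInvariant`, which makes the time derivative of the form vanish in the interaction
picture (`exchangeForm_torusGroup`). -/

open scoped InnerProductSpace
open Filter Topology

/-! ### Calculus of strongly continuous operator families and one-parameter groups -/

section StrongFamilies

variable {H : Type*} [NormedAddCommGroup H] [InnerProductSpace ℂ H]

/-- A uniformly bounded strongly convergent family applied to a convergent family. -/
lemma tendsto_clm_apply_of_bound {α : Type*} {l : Filter α} {L : α → H →L[ℂ] H} {M : ℝ}
    (hM : ∀ t x, ‖L t x‖ ≤ M * ‖x‖) {u : α → H} {a c : H} (hu : Tendsto u l (𝓝 a))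
    (hL : Tendsto (fun t => L t a) l (𝓝 c)) : Tendsto (fun t => L t (u t)) l (𝓝 c) := by
  have h0 : Tendsto (fun t => L t (u t - a)) l (𝓝 0) := by
    refine squeeze_zero_norm (fun t => hM t _) ?_
    have : Tendsto (fun t => ‖u t - a‖) l (𝓝 0) := by
      simpa using (hu.sub_const a).norm
    simpa using this.const_mul M
  simpa using h0.add hL

lemma continuous_clm_apply_of_bound {L : ℝ → H →L[ℂ] H} {M : ℝ}
    (hM : ∀ t x, ‖L t x‖ ≤ M * ‖x‖) (hL : ∀ x, Continuous fun t => L t x) {u : ℝ → H}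
    (hu : Continuous u) : Continuous fun t => L t (u t) :=
  continuous_iff_continuousAt.2 fun t =>
    tendsto_clm_apply_of_bound hM hu.continuousAt (hL (u t)).continuousAt

/-- Product rule for a uniformly bounded strongly continuous family of operators. -/
lemma hasDerivAt_clm_apply_of_bound {L : ℝ → H →L[ℂ] H} {M : ℝ}
    (hM : ∀ t x, ‖L t x‖ ≤ M * ‖x‖) {u : ℝ → H} {u' d : H} {t : ℝ}
    (hL : ContinuousAt (fun s => L s u') t)
    (hu : HasDerivAt u u' t) (hd : HasDerivAt (fun s => L s (u t)) d t) :
    HasDerivAt (fun s => L s (u s)) (L t u' + d) t := by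
  rw [hasDerivAt_iff_tendsto_slope] at hu hd ⊢
  have h1 : Tendsto (fun s => L s (slope u t s)) (𝓝[≠] t) (𝓝 (L t u')) :=
    tendsto_clm_apply_of_bound hM hu (hL.tendsto.mono_left nhdsWithin_le_nhds)
  refine (h1.add hd).congr fun s => ?_
  simp only [slope, vsub_eq_sub]
  have : L s ((s - t)⁻¹ • (u s - u t)) = (s - t)⁻¹ • L s (u s - u t) :=
    (L s).toLinearMap.map_smul_of_tower _ _
  rw [this, ← smul_add, map_sub]
  congr 1
  abel

end StrongFamilies

section OneParameterGroups

variable {H : Type*} [NormedAddCommGroup H] [InnerProductSpace ℂ H]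

/-- Differentiability of an orbit of a one-parameter group at all (negated) times. -/
lemma hasDerivAt_group_neg {U : ℝ → H →L[ℂ] H} (hadd : ∀ s t, U (s + t) = (U s).comp (U t))
    {f g : H} (h : HasDerivAt (fun t => U t f) g 0) (t : ℝ) :
    HasDerivAt (fun s => U (-s) f) (-U (-t) g) t := by
  have h0 : HasDerivAt (fun r => U r f) g (t - t) := by rw [sub_self]; exact h
  have h1 := h0.scomp t ((hasDerivAt_id t).const_sub t)
  have h2 := ((U (-t)).restrictScalars ℝ).hasFDerivAt.comp_hasDerivAt t h1
  have hfun : (fun s => U (-s) f) =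
      ⇑((U (-t)).restrictScalars ℝ) ∘ (fun r => U r f) ∘ fun s => t - id s := by
    funext s
    simp only [Function.comp_apply, ContinuousLinearMap.coe_restrictScalars', id]
    rw [← ContinuousLinearMap.comp_apply, ← hadd]
    congr 2; ring
  rw [hfun]
  exact h2.congr_deriv (by simp)

end OneParameterGroups

/-! ### Linear evolution equations with bounded coefficients: Dyson series and uniqueness -/

section Dyson

variable {H : Type*} [NormedAddCommGroup H] [InnerProductSpace ℂ H] [CompleteSpace H]

/-- The terms of the Dyson series for `w' = B(t) w`, `w(0) = F`. -/
noncomputable def dysonTerm (B : ℝ → H →L[ℂ] H) (F : H) : ℕ → ℝ → H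
  | 0 => fun _ => F
  | n + 1 => fun t => ∫ s in (0 : ℝ)..t, B s (dysonTerm B F n s)

variable {B : ℝ → H →L[ℂ] H} {M : ℝ}

omit [CompleteSpace H] in
lemma continuous_dysonTerm (hM : ∀ t x, ‖B t x‖ ≤ M * ‖x‖)
    (hB : ∀ x, Continuous fun t => B t x) (F : H) (n : ℕ) : Continuous (dysonTerm B F n) := by
  induction n with
  | zero => exact continuous_const
  | succ n ih =>
    exact intervalIntegral.continuous_primitive
      (fun a b => (continuous_clm_apply_of_bound hM hB ih).intervalIntegrable a b) 0

lemma hasDerivAt_dysonTerm (hM : ∀ t x, ‖B t x‖ ≤ M * ‖x‖)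
    (hB : ∀ x, Continuous fun t => B t x) (F : H) (n : ℕ) (t : ℝ) :
    HasDerivAt (dysonTerm B F (n + 1)) (B t (dysonTerm B F n t)) t :=
  ((continuous_clm_apply_of_bound hM hB
    (continuous_dysonTerm hM hB F n)).integral_hasStrictDerivAt 0 t).hasDerivAt

omit [CompleteSpace H] in
-- The factorial is the iterated integral of 1 over a simplex; each induction step integrates |s|^n
-- once more. It makes the series converge for every time.
lemma norm_dysonTerm_le (hM0 : 0 ≤ M) (hM : ∀ t x, ‖B t x‖ ≤ M * ‖x‖)
    (hB : ∀ x, Continuous fun t => B t x) (F : H) (n : ℕ) (t : ℝ) :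
    ‖dysonTerm B F n t‖ ≤ (M * |t|) ^ n / n.factorial * ‖F‖ := by
  induction n generalizing t with
  | zero => simp [dysonTerm]
  | succ n ih =>
    have hc := continuous_clm_apply_of_bound hM hB (continuous_dysonTerm hM hB F n)
    have hg : Continuous fun s : ℝ => M ^ (n + 1) / n.factorial * ‖F‖ * |s - 0| ^ n := by
      fun_prop
    calc ‖dysonTerm B F (n + 1) t‖
        ≤ ∫ s in Set.uIoc 0 t, ‖B s (dysonTerm B F n s)‖ :=
          intervalIntegral.norm_integral_le_integral_norm_uIoc
      _ ≤ ∫ s in Set.uIoc 0 t, M ^ (n + 1) / n.factorial * ‖F‖ * |s - 0| ^ n := by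
          refine setIntegral_mono (hc.norm.integrableOn_uIoc) hg.integrableOn_uIoc fun s => ?_
          refine (hM s _).trans ((mul_le_mul_of_nonneg_left (ih s) hM0).trans_eq ?_)
          rw [sub_zero]; ring
      _ = (M * |t|) ^ (n + 1) / (n + 1).factorial * ‖F‖ := by
          rw [integral_const_mul, integral_pow_abs_sub_uIoc, Nat.factorial_succ]
          push_cast
          have : (n.factorial : ℝ) ≠ 0 := by positivity
          rw [sub_zero, mul_pow]
          field_simp

/-- Global solvability of a linear equation with bounded strongly continuous coefficients. -/
lemma exists_hasDerivAt_of_strongly_continuous (hM : ∀ t x, ‖B t x‖ ≤ M * ‖x‖) (hM0 : 0 ≤ M)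
    (hB : ∀ x, Continuous fun t => B t x) (F : H) :
    ∃ w : ℝ → H, w 0 = F ∧ ∀ t, HasDerivAt w (B t (w t)) t := by
  have hsum : ∀ T : ℝ, Summable fun n : ℕ => (M * T) ^ n / n.factorial * ‖F‖ := fun T =>
    (Real.summable_pow_div_factorial (M * T)).mul_right _
  have hs : ∀ t, Summable fun n => dysonTerm B F n t := fun t =>
    Summable.of_norm_bounded (hsum |t|) fun n => norm_dysonTerm_le hM0 hM hB F n t
  have hzero : ∀ n, dysonTerm B F (n + 1) 0 = 0 := fun n => by simp [dysonTerm]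
  refine ⟨fun t => F + ∑' n, dysonTerm B F (n + 1) t, by simp [hzero], fun t => ?_⟩
  -- Applying B(t) term by term shifts the index by one, so the right-hand side is exactly the sum
  -- of the derivatives of the terms.
  have hval : B t (F + ∑' n, dysonTerm B F (n + 1) t) = ∑' n, B t (dysonTerm B F n t) := by
    rw [← (B t).map_tsum (hs t), (hs t).tsum_eq_zero_add]
    rfl
  rw [hval]
  refine HasDerivAt.const_add _ ?_
  have ht : t ∈ Set.Ioo (-(|t| + 1)) (|t| + 1) := by
    constructor <;> cases abs_cases t <;> linarith
  -- Termwise differentiation needs one summable majorant of the derivatives; it is available on a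
  -- bounded interval, chosen symmetric to contain both 0 and t.
  refine hasDerivAt_tsum_of_isPreconnected (t := Set.Ioo (-(|t| + 1)) (|t| + 1))
    (y₀ := 0) ((hsum (|t| + 1)).mul_left M)
    isOpen_Ioo isPreconnected_Ioo (fun n y _ => hasDerivAt_dysonTerm hM hB F n y) ?_ ?_ ?_ ht
  · intro n y hy
    refine (hM y _).trans (mul_le_mul_of_nonneg_left ?_ hM0)
    refine (norm_dysonTerm_le hM0 hM hB F n y).trans ?_
    have : |y| ≤ |t| + 1 := (abs_lt.2 hy).le
    gcongr
  · constructor <;> linarith [abs_nonneg t]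
  · simp [hzero]

end Dyson

section SkewEvolution

variable {H : Type*} [NormedAddCommGroup H] [InnerProductSpace ℂ H]

/-- The norm is conserved by an equation with skew coefficients. -/
lemma norm_eq_of_skew {B : ℝ → H →L[ℂ] H} (hskew : ∀ t x, (⟪x, B t x⟫_ℂ).re = 0) {w : ℝ → H}
    (hw : ∀ t, HasDerivAt w (B t (w t)) t) (t : ℝ) : ‖w t‖ = ‖w 0‖ := by
  have hd : ∀ t, HasDerivAt (fun s => (⟪w s, w s⟫_ℂ).re) 0 t := fun t => by
    have h := ((hw t).inner ℂ (hw t))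
    refine (Complex.reCLM.hasFDerivAt.comp_hasDerivAt t h).congr_deriv ?_
    simp only [Complex.reCLM_apply, Complex.add_re, hskew, zero_add]
    rw [← inner_conj_symm, Complex.conj_re, hskew]
  have hc := is_const_of_deriv_eq_zero (fun s => (hd s).differentiableAt) (fun s => (hd s).deriv) t 0
  have h2 : ∀ s, (⟪w s, w s⟫_ℂ).re = ‖w s‖ ^ 2 := fun s => by
    rw [inner_self_eq_norm_sq_to_K]; norm_cast
  simp only [h2] at hc
  exact (pow_left_inj₀ (norm_nonneg _) (norm_nonneg _) two_ne_zero).1 hc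

/-- By linearity the difference of two solutions is a solution, and its norm is constantly zero. -/
lemma eq_of_skew {B : ℝ → H →L[ℂ] H} (hskew : ∀ t x, (⟪x, B t x⟫_ℂ).re = 0) {w v : ℝ → H}
    (hw : ∀ t, HasDerivAt w (B t (w t)) t) (hv : ∀ t, HasDerivAt v (B t (v t)) t)
    (h0 : w 0 = v 0) (t : ℝ) : w t = v t := by
  have h := norm_eq_of_skew hskew (w := fun s => w s - v s)
    (fun s => by rw [map_sub]; exact (hw s).sub (hv s)) t
  rw [h0, sub_self, norm_zero, norm_eq_zero, sub_eq_zero] at h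
  exact h

end SkewEvolution

/-! ### Unitary groups diagonal in a Hilbert basis -/

section DiagonalGroup

variable {H : Type*} [NormedAddCommGroup H] [InnerProductSpace ℂ H] [CompleteSpace H]
variable {ι : Type*} (b : HilbertBasis ι ℂ H) (lam : ι → ℝ)

omit [CompleteSpace H] in
lemma HilbertBasis.clm_ext {F : Type*} [NormedAddCommGroup F] [NormedSpace ℂ F]
    {f g : H →L[ℂ] F} (h : ∀ k, f (b k) = g (b k)) : f = g :=
  ContinuousLinearMap.ext_on (Submodule.dense_iff_topologicalClosure_eq_top.2 b.dense_span)
    (by rintro _ ⟨k, rfl⟩; exact h k)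

omit [CompleteSpace H] in
lemma HilbertBasis.ext_inner {x y : H} (h : ∀ k, ⟪b k, x⟫_ℂ = ⟪b k, y⟫_ℂ) : x = y := by
  apply b.repr.injective
  ext k
  rw [b.repr_apply_apply, b.repr_apply_apply, h]

/-- The phase `e^{-i λ_k t}`. -/
noncomputable def phase (k : ι) (t : ℝ) : ℂ := Complex.exp (-Complex.I * lam k * t)

lemma norm_phase (k : ι) (t : ℝ) : ‖phase lam k t‖ = 1 := by
  have : -Complex.I * lam k * t = ((-(lam k * t) : ℝ) : ℂ) * Complex.I := by push_cast; ring
  rw [phase, this, Complex.norm_exp_ofReal_mul_I]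

lemma phase_add (k : ι) (s t : ℝ) : phase lam k (s + t) = phase lam k s * phase lam k t := by
  rw [phase, phase, phase, ← Complex.exp_add]; push_cast; ring_nf

lemma phase_zero (k : ι) : phase lam k 0 = 1 := by simp [phase]

lemma conj_phase (k : ι) (t : ℝ) : conj (phase lam k t) = phase lam k (-t) := by
  simp [phase, ← Complex.exp_conj]

lemma hasDerivAt_phase (k : ι) (t : ℝ) :
    HasDerivAt (phase lam k) (-Complex.I * lam k * phase lam k t) t := by
  have h : HasDerivAt (fun s : ℝ => -Complex.I * lam k * (s : ℂ)) (-Complex.I * lam k) t := by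
    simpa using (Complex.ofRealCLM.hasDerivAt (x := t)).const_mul (-Complex.I * lam k)
  have := h.cexp
  rw [mul_comm]; exact this

/-- The Hilbert basis `e^{-i λ_k t} b_k`. -/
noncomputable def phaseBasis (t : ℝ) : HilbertBasis ι ℂ H :=
  HilbertBasis.mk (v := fun k => phase lam k t • b k)
    (by
      classical
      rw [orthonormal_iff_ite]
      intro j k
      rw [inner_smul_left, inner_smul_right, orthonormal_iff_ite.1 b.orthonormal]
      split_ifs with h
      · subst h
        rw [mul_one, mul_comm, Complex.mul_conj, Complex.normSq_eq_norm_sq, norm_phase]; simp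
      · simp)
    (by
      rw [← b.dense_span]
      refine Submodule.topologicalClosure_mono (Submodule.span_le.2 ?_)
      rintro _ ⟨k, rfl⟩
      have : b k = phase lam k (-t) • (phase lam k t • b k) := by
        rw [smul_smul, ← phase_add, neg_add_cancel, phase_zero, one_smul]
      rw [this]
      exact Submodule.smul_mem _ _ (Submodule.subset_span ⟨k, rfl⟩))

/-- The unitary group acting on the basis vector `b_k` by `e^{-i λ_k t}`. -/
noncomputable def diagGroup (t : ℝ) : H →L[ℂ] H :=
  (b.repr.trans (phaseBasis b lam t).repr.symm).toLinearIsometry.toContinuousLinearMap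

lemma norm_diagGroup (t : ℝ) (x : H) : ‖diagGroup b lam t x‖ = ‖x‖ :=
  (b.repr.trans (phaseBasis b lam t).repr.symm).norm_map x

lemma inner_diagGroup (t : ℝ) (x y : H) :
    ⟪diagGroup b lam t x, diagGroup b lam t y⟫_ℂ = ⟪x, y⟫_ℂ :=
  (b.repr.trans (phaseBasis b lam t).repr.symm).inner_map_map x y

lemma diagGroup_basis (t : ℝ) (k : ι) : diagGroup b lam t (b k) = phase lam k t • b k := by
  classical
  change (phaseBasis b lam t).repr.symm (b.repr (b k)) = _
  rw [b.repr_self, HilbertBasis.repr_symm_single, phaseBasis, HilbertBasis.coe_mk]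

lemma diagGroup_zero (x : H) : diagGroup b lam 0 x = x := by
  have : diagGroup b lam 0 = ContinuousLinearMap.id ℂ H :=
    b.clm_ext fun k => by simp [diagGroup_basis, phase_zero]
  rw [this]; rfl

lemma diagGroup_add (s t : ℝ) (x : H) :
    diagGroup b lam (s + t) x = diagGroup b lam s (diagGroup b lam t x) := by
  have : diagGroup b lam (s + t) = (diagGroup b lam s).comp (diagGroup b lam t) :=
    b.clm_ext fun k => by
      simp [diagGroup_basis, phase_add, smul_smul, mul_comm]
  rw [this]; rfl

lemma diagGroup_self_neg (t : ℝ) (x : H) : diagGroup b lam t (diagGroup b lam (-t) x) = x := by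
  rw [← diagGroup_add, add_neg_cancel, diagGroup_zero]

lemma inner_diagGroup_left (t : ℝ) (x y : H) :
    ⟪diagGroup b lam t x, y⟫_ℂ = ⟪x, diagGroup b lam (-t) y⟫_ℂ := by
  rw [← inner_diagGroup b lam t x, diagGroup_self_neg]

lemma inner_basis_diagGroup (t : ℝ) (k : ι) (x : H) :
    ⟪b k, diagGroup b lam t x⟫_ℂ = phase lam k t * ⟪b k, x⟫_ℂ := by
  have := inner_diagGroup_left b lam (-t) (b k) x
  rw [neg_neg] at this
  rw [← this, diagGroup_basis, inner_smul_left, conj_phase, neg_neg]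

omit [CompleteSpace H] in
/-- Strong continuity of a family of isometries may be checked on a Hilbert basis. -/
lemma continuous_of_basis {L : ℝ → H →L[ℂ] H} (hL : ∀ t x, ‖L t x‖ = ‖x‖)
    (hb : ∀ k, Continuous fun t => L t (b k)) (x : H) : Continuous fun t => L t x := by
  have hx : x ∈ (Submodule.span ℂ (Set.range b)).topologicalClosure := by
    rw [b.dense_span]; trivial
  have hspan : ∀ y ∈ Submodule.span ℂ (Set.range b), Continuous fun t => L t y := by
    intro y hy
    induction hy using Submodule.span_induction with
    | mem y hy => obtain ⟨k, rfl⟩ := hy; exact hb k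
    | zero => simpa using continuous_const
    | add y z _ _ hy hz => simp only [map_add]; exact hy.add hz
    | smul c y _ hy => simp only [map_smul]; exact hy.const_smul c
  obtain ⟨u, hu, hlim⟩ := mem_closure_iff_seq_limit.1 hx
  have hunif : TendstoUniformly (fun n t => L t (u n)) (fun t => L t x) atTop := by
    rw [Metric.tendstoUniformly_iff]
    intro ε hε
    filter_upwards [(Metric.tendsto_nhds.1 hlim) ε hε] with n hn t
    rw [dist_comm, dist_eq_norm, ← map_sub, hL, ← dist_eq_norm]
    exact hn
  exact hunif.continuous (Frequently.of_forall fun n => hspan _ (hu n))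

lemma continuous_diagGroup (x : H) : Continuous fun t => diagGroup b lam t x := by
  refine continuous_of_basis b (norm_diagGroup b lam) (fun k => ?_) x
  simp_rw [diagGroup_basis]
  exact (continuous_iff_continuousAt.2 fun t =>
    (hasDerivAt_phase lam k t).continuousAt).smul continuous_const

lemma continuous_diagGroup_neg (x : H) : Continuous fun t => diagGroup b lam (-t) x :=
  (continuous_diagGroup b lam x).comp continuous_neg

/-- A continuous curve that is differentiable in every coordinate, with derivative given by the
coordinates of a continuous curve, is differentiable. -/
lemma hasDerivAt_of_inner_basis {w v : ℝ → H} (hv : Continuous v)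
    (h : ∀ k t, HasDerivAt (fun s => ⟪b k, w s⟫_ℂ) ⟪b k, v t⟫_ℂ t) (t : ℝ) :
    HasDerivAt w (v t) t := by
  -- The fundamental theorem of calculus holds in each coordinate, hence in H. The vector integral
  -- is then differentiable because v is continuous.
  have heq : w = fun t => w 0 + ∫ s in (0 : ℝ)..t, v s := by
    funext t
    refine b.ext_inner fun k => ?_
    have h1 : ∫ s in (0 : ℝ)..t, ⟪b k, v s⟫_ℂ = ⟪b k, w t⟫_ℂ - ⟪b k, w 0⟫_ℂ :=
      intervalIntegral.integral_eq_sub_of_hasDerivAt (fun s _ => h k s)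
        ((continuous_const.inner hv).intervalIntegrable _ _)
    have h2 : ∫ s in (0 : ℝ)..t, ⟪b k, v s⟫_ℂ = ⟪b k, ∫ s in (0 : ℝ)..t, v s⟫_ℂ :=
      (innerSL ℂ (b k)).intervalIntegral_comp_comm (hv.intervalIntegrable _ _)
    rw [inner_add_right, ← h2, h1]; ring
  rw [heq]
  exact ((hv.integral_hasStrictDerivAt 0 t).hasDerivAt).const_add _

/-- The hypothesis says that f lies in the domain of diag λ with image g, expressed through
coordinates alone. -/
lemma hasDerivAt_diagGroup {f g : H} (hfg : ∀ k, ⟪b k, g⟫_ℂ = lam k * ⟪b k, f⟫_ℂ) (t : ℝ) :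
    HasDerivAt (fun s => diagGroup b lam s f) (-Complex.I • diagGroup b lam t g) t := by
  refine hasDerivAt_of_inner_basis b (v := fun t => -Complex.I • diagGroup b lam t g)
    ((continuous_diagGroup b lam g).const_smul _) (fun k t => ?_) t
  simp_rw [inner_smul_right, inner_basis_diagGroup, hfg]
  exact ((hasDerivAt_phase lam k t).mul_const ⟪b k, f⟫_ℂ).congr_deriv (by ring)

end DiagonalGroup

/-! ### Bounded symmetric perturbations in the interaction picture -/

section PerturbedGroup

variable {H : Type*} [NormedAddCommGroup H] [InnerProductSpace ℂ H] [CompleteSpace H]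
variable {ι : Type*} (b : HilbertBasis ι ℂ H) (lam : ι → ℝ) (A : H →L[ℂ] H)

/-- The perturbation `-iA` in the interaction picture of the diagonal group. -/
noncomputable def interactionGenerator (t : ℝ) : H →L[ℂ] H :=
  -Complex.I • ((diagGroup b lam (-t)).comp (A.comp (diagGroup b lam t)))

lemma interactionGenerator_apply (t : ℝ) (x : H) : interactionGenerator b lam A t x =
    -Complex.I • diagGroup b lam (-t) (A (diagGroup b lam t x)) := rfl

lemma norm_interactionGenerator_le (t : ℝ) (x : H) :
    ‖interactionGenerator b lam A t x‖ ≤ ‖A‖ * ‖x‖ := by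
  rw [interactionGenerator_apply, norm_smul, norm_diagGroup, norm_neg, Complex.norm_I, one_mul]
  exact (A.le_opNorm _).trans_eq (by rw [norm_diagGroup])

lemma continuous_interactionGenerator (x : H) :
    Continuous fun t => interactionGenerator b lam A t x := by
  refine Continuous.const_smul (continuous_clm_apply_of_bound (M := 1)
    (L := fun t => diagGroup b lam (-t)) (fun t x => by rw [norm_diagGroup, one_mul])
    (continuous_diagGroup_neg b lam) ?_) _
  exact A.continuous.comp (continuous_diagGroup b lam x)

variable {A} (hA : ∀ x y, ⟪A x, y⟫_ℂ = ⟪x, A y⟫_ℂ)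
include hA

/-- Conjugation by the unitary D(t) keeps A symmetric, so its quadratic form is real, and the factor
-i makes it purely imaginary. -/
lemma interactionGenerator_skew (t : ℝ) (x : H) :
    (⟪x, interactionGenerator b lam A t x⟫_ℂ).re = 0 := by
  have h := inner_diagGroup_left b lam t x (A (diagGroup b lam t x))
  rw [interactionGenerator_apply, inner_smul_right, ← h]
  have : (⟪diagGroup b lam t x, A (diagGroup b lam t x)⟫_ℂ).im = 0 := by
    rw [← Complex.conj_eq_iff_im, inner_conj_symm, hA]
  simp [this]

omit hA in
/-- The solution of the evolution equation in the interaction picture. -/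
noncomputable def interactionCurve (A : H →L[ℂ] H) (F : H) : ℝ → H :=
  (exists_hasDerivAt_of_strongly_continuous (norm_interactionGenerator_le b lam A)
    (norm_nonneg A) (continuous_interactionGenerator b lam A) F).choose

omit hA in
lemma interactionCurve_zero (A : H →L[ℂ] H) (F : H) : interactionCurve b lam A F 0 = F :=
  (exists_hasDerivAt_of_strongly_continuous (norm_interactionGenerator_le b lam A)
    (norm_nonneg A) (continuous_interactionGenerator b lam A) F).choose_spec.1

omit hA in
lemma hasDerivAt_interactionCurve (A : H →L[ℂ] H) (F : H) (t : ℝ) :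
    HasDerivAt (interactionCurve b lam A F)
      (interactionGenerator b lam A t (interactionCurve b lam A F t)) t :=
  (exists_hasDerivAt_of_strongly_continuous (norm_interactionGenerator_le b lam A)
    (norm_nonneg A) (continuous_interactionGenerator b lam A) F).choose_spec.2 t

lemma interactionCurve_unique {w : ℝ → H} {F : H} (h0 : w 0 = F)
    (hw : ∀ t, HasDerivAt w (interactionGenerator b lam A t (w t)) t) (t : ℝ) :
    w t = interactionCurve b lam A F t :=
  eq_of_skew (interactionGenerator_skew b lam hA) hw (hasDerivAt_interactionCurve b lam A F)
    (by rw [h0, interactionCurve_zero]) t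

lemma norm_interactionCurve (F : H) (t : ℝ) : ‖interactionCurve b lam A F t‖ = ‖F‖ := by
  rw [norm_eq_of_skew (interactionGenerator_skew b lam hA)
    (hasDerivAt_interactionCurve b lam A F), interactionCurve_zero]

/-- The group generated by `-i (diag λ + A)`. -/
noncomputable def perturbedGroup (t : ℝ) : H →L[ℂ] H :=
  (diagGroup b lam t).comp (LinearIsometry.toContinuousLinearMap (show H →ₗᵢ[ℂ] H from
    { toFun := fun F => interactionCurve b lam A F t
      -- Linearity in the initial value follows from uniqueness: sums and multiples of solutions are
      -- solutions with the corresponding data.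
      map_add' := fun F G => by
        refine (interactionCurve_unique b lam hA (F := F + G)
          (w := fun t => interactionCurve b lam A F t + interactionCurve b lam A G t)
          (by simp [interactionCurve_zero]) (fun s => ?_) t).symm
        rw [map_add]
        exact (hasDerivAt_interactionCurve b lam A F s).add (hasDerivAt_interactionCurve b lam A G s)
      map_smul' := fun c F => by
        change interactionCurve b lam A (c • F) t = c • interactionCurve b lam A F t
        refine (interactionCurve_unique b lam hA (F := c • F)
          (w := fun t => c • interactionCurve b lam A F t)
          (by simp [interactionCurve_zero]) (fun s => ?_) t).symm
        rw [map_smul]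
        exact (hasDerivAt_interactionCurve b lam A F s).const_smul c
      norm_map' := fun F => norm_interactionCurve b lam hA F t }))

lemma perturbedGroup_apply (t : ℝ) (F : H) :
    perturbedGroup b lam hA t F = diagGroup b lam t (interactionCurve b lam A F t) := rfl

lemma norm_perturbedGroup (t : ℝ) (F : H) : ‖perturbedGroup b lam hA t F‖ = ‖F‖ := by
  rw [perturbedGroup_apply, norm_diagGroup, norm_interactionCurve b lam hA]

lemma perturbedGroup_zero : perturbedGroup b lam hA 0 = ContinuousLinearMap.id ℂ H := by
  ext F
  rw [perturbedGroup_apply, diagGroup_zero, interactionCurve_zero]; rfl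

/-- Writing B(s) for the interaction generator, D(t) B(s + t) = B(s) D(t). So s ↦ D(t) w(s + t)
solves the interaction equation starting from D(t) w(t), and uniqueness identifies it. -/
lemma perturbedGroup_add (s t : ℝ) : perturbedGroup b lam hA (s + t) =
    (perturbedGroup b lam hA s).comp (perturbedGroup b lam hA t) := by
  ext F
  have h := interactionCurve_unique b lam hA (F := perturbedGroup b lam hA t F)
    (w := fun s => diagGroup b lam t (interactionCurve b lam A F (s + t)))
    (by rw [zero_add]; rfl) (fun s => ?_) s
  · rw [ContinuousLinearMap.comp_apply, perturbedGroup_apply _ _ _ s, ← h,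
      perturbedGroup_apply, diagGroup_add]
  · have h1 := (hasDerivAt_interactionCurve b lam A F (s + t)).comp_add_const s t
    have h2 := ((diagGroup b lam t).restrictScalars ℝ).hasFDerivAt.comp_hasDerivAt s h1
    refine h2.congr_deriv ?_
    rw [interactionGenerator_apply, ContinuousLinearMap.coe_restrictScalars',
      interactionGenerator_apply, map_smul, ← diagGroup_add, ← diagGroup_add,
      show t + -(s + t) = -s by ring]

lemma continuous_perturbedGroup (F : H) : Continuous fun t => perturbedGroup b lam hA t F :=
  continuous_clm_apply_of_bound (M := 1) (L := diagGroup b lam)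
    (fun t x => by rw [norm_diagGroup, one_mul]) (continuous_diagGroup b lam)
    (continuous_iff_continuousAt.2 fun t => (hasDerivAt_interactionCurve b lam A F t).continuousAt)

lemma hasDerivAt_perturbedGroup_zero {f g : H} (hfg : ∀ k, ⟪b k, g⟫_ℂ = lam k * ⟪b k, f⟫_ℂ) :
    HasDerivAt (fun t => perturbedGroup b lam hA t f) (-Complex.I • (g + A f)) 0 := by
  have h1 := hasDerivAt_interactionCurve b lam A f 0
  rw [interactionCurve_zero, interactionGenerator_apply, neg_zero, diagGroup_zero,
    diagGroup_zero] at h1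
  have h2 := hasDerivAt_diagGroup b lam hfg 0
  rw [diagGroup_zero] at h2
  have h := hasDerivAt_clm_apply_of_bound (M := 1) (L := diagGroup b lam) (t := 0)
    (u := interactionCurve b lam A f)
    (fun t x => by rw [norm_diagGroup, one_mul]) (continuous_diagGroup b lam _).continuousAt h1
    (by rw [interactionCurve_zero]; exact h2)
  rw [diagGroup_zero, ← smul_add, add_comm] at h
  exact h

/-- A strongly continuous isometric group whose generator is `-i (diag λ + A)` on the basis vectors
is the perturbed group. -/
lemma eq_perturbedGroup {U : ℝ → H →L[ℂ] H} (hnorm : ∀ t x, ‖U t x‖ = ‖x‖)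
    (hzero : U 0 = ContinuousLinearMap.id ℂ H) (hadd : ∀ s t, U (s + t) = (U s).comp (U t))
    (hcont : ∀ x, Continuous fun t => U t x)
    (hgen : ∀ k, HasDerivAt (fun t => U t (b k))
      (-Complex.I • ((lam k : ℂ) • b k + A (b k))) 0) :
    U = perturbedGroup b lam hA := by
  have hinner : ∀ t x y, ⟪U t x, U t y⟫_ℂ = ⟪x, y⟫_ℂ := fun t x y =>
    LinearIsometry.inner_map_map ⟨(U t).toLinearMap, hnorm t⟩ x y
  have hadj : ∀ t x y, ⟪x, U t y⟫_ℂ = ⟪U (-t) x, y⟫_ℂ := fun t x y => by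
    rw [← hinner (-t) x, ← ContinuousLinearMap.comp_apply, ← hadd, neg_add_cancel, hzero]; rfl
  have hderiv : ∀ k t, HasDerivAt (fun s => U (-s) (b k))
      (Complex.I • U (-t) ((lam k : ℂ) • b k + A (b k))) t := fun k t =>
    (hasDerivAt_group_neg hadd (hgen k) t).congr_deriv (by rw [map_smul, neg_smul, neg_neg])
  funext t
  ext F
  -- The vector F need not lie in the domain of the generator, so s ↦ U(s) F cannot be
  -- differentiated directly. In the k-th coordinate U(s) is moved to the other side as U(-s) acting
  -- on `b k`, where the generator is known.
  have key : ∀ t, HasDerivAt (fun s => diagGroup b lam (-s) (U s F))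
      (interactionGenerator b lam A t (diagGroup b lam (-t) (U t F))) t := by
    intro t
    refine hasDerivAt_of_inner_basis b
      (v := fun t => interactionGenerator b lam A t (diagGroup b lam (-t) (U t F))) ?_ ?_ t
    · exact continuous_clm_apply_of_bound (norm_interactionGenerator_le b lam A)
        (continuous_interactionGenerator b lam A)
        (continuous_clm_apply_of_bound (M := 1) (L := fun t => diagGroup b lam (-t))
          (fun t x => by rw [norm_diagGroup, one_mul]) (continuous_diagGroup_neg b lam) (hcont F))
    · intro k t
      simp_rw [interactionGenerator_apply, diagGroup_self_neg, inner_smul_right,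
        inner_basis_diagGroup, hadj]
      have h1 := (hderiv k t).inner ℂ (hasDerivAt_const t F)
      have h2 : HasDerivAt (fun s => phase lam k (-s)) (Complex.I * lam k * phase lam k (-t)) t := by
        have := (hasDerivAt_phase lam k (-t)).scomp t (hasDerivAt_neg t)
        exact this.congr_deriv (by simp)
      refine (h2.mul h1).congr_deriv ?_
      -- The contributions of `lam k` from the phase and from the generator cancel; only the term
      -- with A survives, moved back by symmetry.
      rw [inner_zero_right, zero_add, inner_smul_left, ← hadj, ← hadj, inner_add_left,
        inner_smul_left, hA]
      simp only [Complex.conj_I, Complex.conj_ofReal]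
      ring
  have h := interactionCurve_unique b lam hA (F := F)
    (w := fun s => diagGroup b lam (-s) (U s F)) (by simp [hzero, diagGroup_zero]) key t
  rw [perturbedGroup_apply, ← h, diagGroup_self_neg]

end PerturbedGroup

/-! ### Multiplication operators and continuous functions in L² -/

section Multiplication

variable {X : Type*} [TopologicalSpace X] [CompactSpace X] [MeasurableSpace X] [BorelSpace X]
variable {μ : Measure X}

omit [MeasurableSpace X] [BorelSpace X] in
lemma norm_ofReal_mul_le (V : C(X, ℝ)) (x : X) (z : ℂ) : ‖(V x : ℂ) * z‖ ≤ ‖V‖ * ‖z‖ := by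
  rw [norm_mul, Complex.norm_real]
  exact mul_le_mul_of_nonneg_right (V.norm_coe_le_norm x) (norm_nonneg _)

lemma memLp_ofReal_mul (V : C(X, ℝ)) {f : X → ℂ} (hf : MemLp f 2 μ) :
    MemLp (fun x => (V x : ℂ) * f x) 2 μ :=
  hf.of_le_mul (c := ‖V‖)
    ((Complex.continuous_ofReal.comp V.continuous).measurable.aestronglyMeasurable.mul hf.1)
    (ae_of_all _ fun x => norm_ofReal_mul_le V x (f x))

/-- Multiplication by a real continuous function on `L²` of a compact space. -/
noncomputable def mulOp (μ : Measure X) (V : C(X, ℝ)) : Lp ℂ 2 μ →L[ℂ] Lp ℂ 2 μ :=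
  LinearMap.mkContinuous
    { toFun := fun f => (memLp_ofReal_mul V (Lp.memLp f)).toLp _
      map_add' := fun f g => by
        rw [← MemLp.toLp_add, MemLp.toLp_eq_toLp_iff]
        filter_upwards [Lp.coeFn_add f g] with x hx
        exact (congrArg ((V x : ℂ) * ·) hx).trans (mul_add _ _ _)
      map_smul' := fun c f => by
        rw [RingHom.id_apply, ← MemLp.toLp_const_smul, MemLp.toLp_eq_toLp_iff]
        filter_upwards [Lp.coeFn_smul c f] with x hx
        exact (congrArg ((V x : ℂ) * ·) hx).trans (mul_left_comm _ _ _) }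
    ‖V‖ (fun f => Lp.norm_le_mul_norm_of_ae_le_mul (by
      filter_upwards [(memLp_ofReal_mul V (Lp.memLp f)).coeFn_toLp] with x hx
      exact (congrArg norm hx).trans_le (norm_ofReal_mul_le V x _)))

lemma coeFn_mulOp (V : C(X, ℝ)) (f : Lp ℂ 2 μ) :
    mulOp μ V f =ᵐ[μ] fun x => (V x : ℂ) * f x :=
  (memLp_ofReal_mul V (Lp.memLp f)).coeFn_toLp

lemma inner_mulOp (V : C(X, ℝ)) (f g : Lp ℂ 2 μ) : ⟪mulOp μ V f, g⟫_ℂ = ⟪f, mulOp μ V g⟫_ℂ := by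
  rw [L2.inner_def, L2.inner_def]
  refine integral_congr_ae ?_
  filter_upwards [coeFn_mulOp V f, coeFn_mulOp V g] with x hf hg
  rw [hf, hg]
  simp only [RCLike.inner_apply, map_mul, Complex.conj_ofReal]
  ring

end Multiplication

section TorusInstances

variable {m d : ℕ}

instance instBorelSpaceConfig : BorelSpace (Config m d) := Pi.borelSpace

instance instIsProbabilityMeasureCircle :
    IsProbabilityMeasure (volume : Measure UnitAddCircle) := ⟨by simp⟩

instance instIsAddLeftInvariantTorus : (volume : Measure (Torus d)).IsAddLeftInvariant :=
  inferInstance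

instance instIsAddLeftInvariantConfig : (volume : Measure (Config m d)).IsAddLeftInvariant :=
  Measure.pi.isAddLeftInvariant _

end TorusInstances

section ToL2

variable {m d : ℕ}

lemma toL2_of_memLp {f : Config m d → ℂ} (hf : MemLp f 2 (volume : Measure (Config m d))) :
    toL2 f = hf.toLp f := dif_pos hf

lemma memLp_of_continuous {f : Config m d → ℂ} (hf : Continuous f) :
    MemLp f 2 (volume : Measure (Config m d)) :=
  hf.memLp_of_hasCompactSupport (HasCompactSupport.of_compactSpace f)

lemma coeFn_toL2 {f : Config m d → ℂ} (hf : Continuous f) : toL2 f =ᵐ[volume] f := by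
  rw [toL2_of_memLp (memLp_of_continuous hf)]
  exact MemLp.coeFn_toLp _

lemma toL2_add {f g : Config m d → ℂ} (hf : Continuous f) (hg : Continuous g) :
    toL2 (fun x => f x + g x) = toL2 f + toL2 g := by
  rw [toL2_of_memLp (memLp_of_continuous hf), toL2_of_memLp (memLp_of_continuous hg),
    ← MemLp.toLp_add]
  exact toL2_of_memLp (memLp_of_continuous (hf.add hg))

lemma toL2_const_mul {f : Config m d → ℂ} (hf : Continuous f) (c : ℂ) :
    toL2 (fun x => c * f x) = c • toL2 f := by
  rw [toL2_of_memLp (memLp_of_continuous hf), ← MemLp.toLp_const_smul]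
  exact toL2_of_memLp (memLp_of_continuous (hf.const_smul c))

lemma toL2_zero : toL2 (0 : Config m d → ℂ) = 0 := by
  rw [toL2_of_memLp (memLp_of_continuous continuous_zero)]
  exact MemLp.toLp_zero _

lemma toL2_sum {ι : Type*} (s : Finset ι) {f : ι → Config m d → ℂ} (hf : ∀ i, Continuous (f i)) :
    toL2 (fun x => ∑ i ∈ s, f i x) = ∑ i ∈ s, toL2 (f i) := by
  classical
  induction s using Finset.induction_on with
  | empty => exact toL2_zero
  | insert i s hi ih =>
    simp only [Finset.sum_insert hi]
    rw [toL2_add (hf i) (continuous_finsetSum _ fun i _ => hf i), ih]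

lemma toL2_coe (f : C(Config m d, ℂ)) : toL2 f = ContinuousMap.toLp 2 volume ℂ f := by
  apply Lp.ext
  exact (coeFn_toL2 f.continuous).trans (ContinuousMap.coeFn_toLp (𝕜 := ℂ) volume f).symm

lemma inner_toL2 {f g : Config m d → ℂ} (hf : Continuous f) (hg : Continuous g) :
    ⟪toL2 f, toL2 g⟫_ℂ = ∫ x, g x * conj (f x) := by
  have h := ContinuousMap.inner_toLp (𝕜 := ℂ) (volume : Measure (Config m d)) ⟨f, hf⟩ ⟨g, hg⟩
  rw [← toL2_coe, ← toL2_coe] at h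
  exact h

end ToL2

/-! ### The Fourier basis of the torus -/

section FourierModes

variable {m d : ℕ}

/-- The character `x ↦ exp(2πi k·x)` of the torus. -/
noncomputable def torusChar (k : Fin m → Fin d → ℤ) : C(Config m d, ℂ) where
  toFun x := ∏ n, ∏ a, fourier (k n a) (x n a)
  continuous_toFun := by fun_prop

lemma torusChar_apply (k : Fin m → Fin d → ℤ) (x : Config m d) :
    torusChar k x = ∏ n, ∏ a, fourier (k n a) (x n a) := rfl

lemma torusChar_neg (k : Fin m → Fin d → ℤ) (x : Config m d) :
    torusChar (-k) x = conj (torusChar k x) := by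
  simp only [torusChar_apply, Pi.neg_apply, fourier_neg, map_prod]

lemma torusChar_add (k l : Fin m → Fin d → ℤ) (x : Config m d) :
    torusChar (k + l) x = torusChar k x * torusChar l x := by
  simp only [torusChar_apply, Pi.add_apply, fourier_add, ← Finset.prod_mul_distrib]

lemma torusChar_zero : torusChar (0 : Fin m → Fin d → ℤ) = 1 := by
  ext x
  simp [torusChar_apply]

lemma torusChar_single (n : Fin m) (a : Fin d) (x : Config m d) :
    torusChar (Pi.single n (Pi.single a 1)) x = fourier 1 (x n a) := by
  rw [torusChar_apply, Finset.prod_eq_single n, Finset.prod_eq_single a]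
  · simp
  · intro b _ hb; simp [hb]
  · simp
  · intro j _ hj; simp [hj]
  · simp

/-- The star subalgebra of trigonometric polynomials. -/
noncomputable def trigSubalgebra (m d : ℕ) : StarSubalgebra ℂ C(Config m d, ℂ) where
  toSubalgebra := Algebra.adjoin ℂ (Set.range torusChar)
  star_mem' := by
    change Algebra.adjoin ℂ (Set.range torusChar) ≤ star (Algebra.adjoin ℂ (Set.range torusChar))
    refine Algebra.adjoin_le ?_
    rintro _ ⟨n, rfl⟩
    refine Algebra.subset_adjoin ⟨-n, ?_⟩
    ext1 x
    simp only [torusChar_neg, starRingEnd_apply, ContinuousMap.star_apply]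

/-- Products of characters are characters, so the algebra they generate is already their linear
span. This transfers Stone–Weierstrass, a statement about algebras, to the span. -/
lemma trigSubalgebra_coe : (trigSubalgebra m d).toSubalgebra.toSubmodule =
    Submodule.span ℂ (Set.range torusChar) := by
  apply Algebra.adjoin_eq_span_of_subset
  refine .trans (fun x => Submonoid.closure_induction (fun _ => id)
    ⟨0, torusChar_zero⟩ ?_) Submodule.subset_span
  rintro _ _ _ _ ⟨k, rfl⟩ ⟨l, rfl⟩
  exact ⟨k + l, by ext x; exact torusChar_add k l x⟩

lemma trigSubalgebra_separatesPoints : (trigSubalgebra m d).SeparatesPoints := by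
  intro x y hxy
  obtain ⟨n, hn⟩ := Function.ne_iff.1 hxy
  obtain ⟨a, ha⟩ := Function.ne_iff.1 hn
  refine ⟨_, ⟨torusChar (Pi.single n (Pi.single a 1)),
    Algebra.subset_adjoin ⟨_, rfl⟩, rfl⟩, ?_⟩
  change torusChar _ x ≠ torusChar _ y
  rw [torusChar_single, torusChar_single, fourier_one, fourier_one]
  exact fun h => ha (AddCircle.injective_toCircle one_ne_zero (Circle.coe_injective h))

lemma span_torusChar_dense : (Submodule.span ℂ
    (Set.range (torusChar (m := m) (d := d)))).topologicalClosure = ⊤ := by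
  rw [← trigSubalgebra_coe]
  exact congrArg (Subalgebra.toSubmodule <| StarSubalgebra.toSubalgebra ·)
    (ContinuousMap.starSubalgebra_topologicalClosure_eq_top_of_separatesPoints _
      trigSubalgebra_separatesPoints)

lemma integral_fourier_mul_conj (k l : ℤ) :
    ∫ x : UnitAddCircle, fourier k x * conj (fourier l x) = if l = k then 1 else 0 := by
  have h := orthonormal_iff_ite.1 (orthonormal_fourier (T := 1)) l k
  rw [ContinuousMap.inner_toLp] at h
  have hv : (volume : Measure UnitAddCircle) = AddCircle.haarAddCircle := by
    rw [AddCircle.volume_eq_smul_haarAddCircle]; simp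
  rw [hv, h]

/-- The integral factors over all circle coordinates, and a single coordinate with different
frequencies makes it vanish. -/
lemma orthonormal_torusChar : Orthonormal ℂ
    (fun k : Fin m → Fin d → ℤ => (toL2 (torusChar k) : L2 m d)) := by
  classical
  rw [orthonormal_iff_ite]
  intro k l
  rw [inner_toL2 (torusChar k).continuous (torusChar l).continuous]
  have h1 : ∀ x : Config m d, torusChar l x * conj (torusChar k x) =
      ∏ n, ∏ a, (fourier (l n a) (x n a) * conj (fourier (k n a) (x n a))) := fun x => by
    simp only [torusChar_apply, map_prod, Finset.prod_mul_distrib]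
  simp_rw [h1]
  rw [integral_fintype_prod_volume_eq_prod
    (fun n (y : Torus d) => ∏ a, (fourier (l n a) (y a) * conj (fourier (k n a) (y a))))]
  have h2 : ∀ n, ∫ y : Torus d, ∏ a, (fourier (l n a) (y a) * conj (fourier (k n a) (y a))) =
      ∏ a, if k n a = l n a then 1 else 0 := fun n => by
    rw [integral_fintype_prod_volume_eq_prod
      (fun a (z : UnitAddCircle) => fourier (l n a) z * conj (fourier (k n a) z))]
    simp_rw [integral_fourier_mul_conj]
  simp_rw [h2]
  split_ifs with h
  · simp [h]
  · obtain ⟨n, hn⟩ := Function.ne_iff.1 h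
    obtain ⟨a, ha⟩ := Function.ne_iff.1 hn
    exact Finset.prod_eq_zero (Finset.mem_univ n)
      (Finset.prod_eq_zero (Finset.mem_univ a) (if_neg ha))

/-- The Fourier basis of `L²(𝕋^{md})`. -/
noncomputable def torusBasis (m d : ℕ) : HilbertBasis (Fin m → Fin d → ℤ) ℂ (L2 m d) :=
  HilbertBasis.mk orthonormal_torusChar (by
    have h := (ContinuousMap.toLp_denseRange (p := 2) ℂ (volume : Measure (Config m d)) ℂ
      (by simp)).topologicalClosure_map_submodule span_torusChar_dense
    have hr : (fun k : Fin m → Fin d → ℤ => (toL2 (torusChar k) : L2 m d)) =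
        fun k => ContinuousMap.toLp 2 volume ℂ (torusChar k) := funext fun k => toL2_coe _
    rw [hr]
    simpa only [Submodule.map_span, ContinuousLinearMap.coe_coe, ← Set.range_comp,
      Function.comp_def] using h.ge)

lemma torusBasis_apply (k : Fin m → Fin d → ℤ) : torusBasis m d k = toL2 (torusChar k) := by
  rw [torusBasis, HilbertBasis.coe_mk]

/-- The eigenvalue `2π²|k|²` of `-½Δ` on the character of frequency `k`. -/
noncomputable def freqEnergy (k : Fin m → Fin d → ℤ) : ℝ :=
  ∑ n, ∑ a, (2 * Real.pi * k n a) ^ 2 / 2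

end FourierModes

/-! ### The Laplacian in Fourier coordinates and the Schrödinger group -/

section DirectionalDerivatives

variable {m d : ℕ}

/-- The displacement by `s` in the coordinate direction `(n, a)`. -/
noncomputable def coordShift (n : Fin m) (a : Fin d) (s : ℝ) : Config m d :=
  Pi.single n (Pi.single a (s : UnitAddCircle))

/-- The partial derivative in the coordinate direction `(n, a)`. -/
noncomputable def partialDeriv (n : Fin m) (a : Fin d) (f : Config m d → ℂ) (x : Config m d) : ℂ :=
  deriv (fun s : ℝ => f (x + coordShift n a s)) 0

lemma coordShift_add (n : Fin m) (a : Fin d) (s t : ℝ) :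
    coordShift n a (s + t) = coordShift n a s + coordShift n a t := by
  rw [coordShift, coordShift, coordShift, ← Pi.single_add, ← Pi.single_add, AddCircle.coe_add]

lemma torusChar_coordShift (k : Fin m → Fin d → ℤ) (n : Fin m) (a : Fin d) (s : ℝ)
    (x : Config m d) : torusChar k (x + coordShift n a s) =
      Complex.exp (2 * Real.pi * Complex.I * k n a * s) * torusChar k x := by
  have h : ∀ y : Config m d, torusChar k (x + y) = torusChar k y * torusChar k x := fun y => by
    simp only [torusChar_apply, ← Finset.prod_mul_distrib]
    refine Finset.prod_congr rfl fun n _ => Finset.prod_congr rfl fun a _ => ?_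
    rw [mul_comm]
    simp [fourier_apply, smul_add, AddCircle.toCircle_add]
  rw [h]
  congr 1
  rw [torusChar_apply, Finset.prod_eq_single n, Finset.prod_eq_single a]
  · rw [coordShift, Pi.single_eq_same, Pi.single_eq_same, fourier_coe_apply]
    congr 1; simp
  · intro b _ hb; simp [coordShift, hb]
  · simp
  · intro j _ hj; simp [coordShift, hj]
  · simp

lemma hasDerivAt_along_shift {n : Fin m} {a : Fin d} {f g : Config m d → ℂ}
    (h : ∀ x, HasDerivAt (fun s : ℝ => f (x + coordShift n a s)) (g x) 0) (x : Config m d) (s : ℝ) :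
    HasDerivAt (fun s : ℝ => f (x + coordShift n a s)) (g (x + coordShift n a s)) s := by
  have h1 : HasDerivAt (fun r : ℝ => f (x + coordShift n a s + coordShift n a r))
      (g (x + coordShift n a s)) (s - s) := by rw [sub_self]; exact h _
  have h2 := h1.comp_sub_const s s
  refine h2.congr_of_eventuallyEq (Eventually.of_forall fun r => ?_)
  simp only
  rw [add_assoc, ← coordShift_add]
  ring_nf

/-- Translation invariance replaces integration by parts: translating f by s multiplies its Fourier
coefficient by an exponential in s, and both sides are differentiated at s = 0. -/
lemma integral_deriv_mul_conj_torusChar {n : Fin m} {a : Fin d} {f g : Config m d → ℂ}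
    (hf : Continuous f) (hg : Continuous g)
    (h : ∀ x, HasDerivAt (fun s : ℝ => f (x + coordShift n a s)) (g x) 0)
    (k : Fin m → Fin d → ℤ) :
    ∫ x, g x * conj (torusChar k x) =
      2 * Real.pi * Complex.I * k n a * ∫ x, f x * conj (torusChar k x) := by
  set c : ℂ := 2 * Real.pi * Complex.I * k n a with hc
  have hval : ∀ s : ℝ, ∫ x, f (x + coordShift n a s) * conj (torusChar k x) =
      Complex.exp (c * s) * ∫ x, f x * conj (torusChar k x) := fun s => by
    rw [← integral_add_right_eq_self (fun x => f x * conj (torusChar k x)) (coordShift n a s),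
      ← integral_const_mul]
    congr 1
    funext x
    rw [torusChar_coordShift, map_mul, ← Complex.exp_conj]
    have : Complex.exp (c * s) * Complex.exp (conj (2 * Real.pi * Complex.I * k n a * s)) = 1 := by
      rw [← Complex.exp_add, ← Complex.exp_zero]
      simp only [hc, map_mul, Complex.conj_I, Complex.conj_ofReal, map_ofNat, map_intCast]
      ring_nf
    linear_combination -(f (x + coordShift n a s) * conj (torusChar k x)) * this
  obtain ⟨C₁, hC₁⟩ := isCompact_univ.exists_bound_of_continuousOn (f := g) hg.continuousOn
  obtain ⟨C₂, hC₂⟩ := isCompact_univ.exists_bound_of_continuousOn (f := torusChar k)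
    (torusChar k).continuous.continuousOn
  have hcont : ∀ (u : Config m d → ℂ), Continuous u → ∀ s : ℝ,
      Continuous fun x => u (x + coordShift n a s) * conj (torusChar k x) := fun u hu s =>
    (hu.comp (continuous_id.add continuous_const)).mul
      (Complex.continuous_conj.comp (torusChar k).continuous)
  have hd := (hasDerivAt_integral_of_dominated_loc_of_deriv_le (μ := volume) (x₀ := (0 : ℝ))
    (F := fun s x => f (x + coordShift n a s) * conj (torusChar k x))
    (F' := fun s x => g (x + coordShift n a s) * conj (torusChar k x))
    (s := Set.univ) (bound := fun _ => C₁ * C₂) univ_mem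
    (Eventually.of_forall fun s => (hcont f hf s).aestronglyMeasurable)
    ((memLp_of_continuous (hcont f hf 0)).integrable (by norm_num))
    (hcont g hg 0).aestronglyMeasurable
    (ae_of_all _ fun x s _ => by
      rw [norm_mul, RCLike.norm_conj]
      exact mul_le_mul (hC₁ _ trivial) (hC₂ x trivial) (norm_nonneg _)
        ((norm_nonneg _).trans (hC₁ x trivial)))
    (integrable_const _)
    (ae_of_all _ fun x s _ => (hasDerivAt_along_shift h x s).mul_const _)).2
  have h0 : coordShift n a 0 = (0 : Config m d) := by simp [coordShift]
  simp only [h0, add_zero, hval] at hd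
  have he : HasDerivAt (fun s : ℝ => Complex.exp (c * s)) c 0 := by
    have := ((Complex.ofRealCLM.hasDerivAt (x := (0 : ℝ))).const_mul c).cexp
    simpa using this
  exact hd.unique (he.mul_const _)

/-- The covering map `ℝ^{md} → 𝕋^{md}`. -/
def torusCover (y : Fin m → Fin d → ℝ) : Config m d := fun n a => (y n a : UnitAddCircle)

/-- `IsC2` only speaks of the periodic lift; the quotient property brings continuity back down to
the torus. -/
lemma isOpenQuotientMap_torusCover : IsOpenQuotientMap (torusCover (m := m) (d := d)) :=
  IsOpenQuotientMap.piMap fun _ => IsOpenQuotientMap.piMap fun _ =>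
    QuotientAddGroup.isOpenQuotientMap_mk

lemma continuous_of_lift {f : Config m d → ℂ} (h : Continuous (f ∘ torusCover)) : Continuous f :=
  isOpenQuotientMap_torusCover.isQuotientMap.continuous_iff.2 h

/-- The unit vector of the coordinate direction `(n, a)`. -/
def coordVec (n : Fin m) (a : Fin d) : Fin m → Fin d → ℝ := Pi.single n (Pi.single a 1)

lemma torusCover_add_coordShift (y : Fin m → Fin d → ℝ) (n : Fin m) (a : Fin d) (s : ℝ) :
    torusCover y + coordShift n a s = torusCover (y + s • coordVec n a) := by
  funext j b
  by_cases hj : j = n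
  · subst hj
    by_cases hb : b = a
    · subst hb; simp [torusCover, coordShift, coordVec]
    · simp [torusCover, coordShift, coordVec, hb]
  · simp [torusCover, coordShift, coordVec, hj]

lemma hasDerivAt_lift {f : Config m d → ℂ} (hf : Differentiable ℝ (f ∘ torusCover))
    (n : Fin m) (a : Fin d) (y : Fin m → Fin d → ℝ) :
    HasDerivAt (fun s : ℝ => f (torusCover y + coordShift n a s))
      (fderiv ℝ (f ∘ torusCover) y (coordVec n a)) 0 := by
  simp_rw [torusCover_add_coordShift]
  have h1 : HasDerivAt (fun s : ℝ => y + s • coordVec n a) (coordVec n a) 0 := by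
    simpa using ((hasDerivAt_id (0 : ℝ)).smul_const (coordVec n a)).const_add y
  have h2 : HasFDerivAt (f ∘ torusCover) (fderiv ℝ (f ∘ torusCover) y)
      (y + (0 : ℝ) • coordVec n a) := by
    simpa using (hf y).hasFDerivAt
  exact h2.comp_hasDerivAt 0 h1

lemma hasDerivAt_partialDeriv {f : Config m d → ℂ} (hf : Differentiable ℝ (f ∘ torusCover))
    (n : Fin m) (a : Fin d) (x : Config m d) :
    HasDerivAt (fun s : ℝ => f (x + coordShift n a s)) (partialDeriv n a f x) 0 := by
  obtain ⟨y, rfl⟩ := isOpenQuotientMap_torusCover.surjective x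
  exact (hasDerivAt_lift hf n a y).differentiableAt.hasDerivAt

lemma contDiff_partialDeriv {f : Config m d → ℂ} {r : ℕ}
    (hf : ContDiff ℝ (r + 1 : ℕ) (f ∘ torusCover)) (n : Fin m) (a : Fin d) :
    ContDiff ℝ r (partialDeriv n a f ∘ torusCover) := by
  have h : partialDeriv n a f ∘ torusCover =
      fun y => fderiv ℝ (f ∘ torusCover) y (coordVec n a) := by
    funext y
    exact (hasDerivAt_lift (hf.differentiable (by simp)) n a y).deriv
  rw [h]
  exact (hf.fderiv_right (m := r) (by norm_cast)).clm_apply contDiff_const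

lemma laplacianIn_eq {f : Config m d → ℂ} (hf : IsC2 f) (n : Fin m) (x : Config m d) :
    laplacianIn n f x = ∑ a, partialDeriv n a (partialDeriv n a f) x := by
  have hf1 : Differentiable ℝ (f ∘ torusCover) := ContDiff.differentiable hf (by simp)
  refine Finset.sum_congr rfl fun a _ => ?_
  rw [iteratedDeriv_succ, iteratedDeriv_one, partialDeriv]
  congr 1
  funext s
  exact (hasDerivAt_along_shift (hasDerivAt_partialDeriv hf1 n a) x s).deriv

lemma IsC2.continuous {f : Config m d → ℂ} (hf : IsC2 f) : Continuous f :=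
  continuous_of_lift (ContDiff.continuous hf)

lemma isC2_torusChar (k : Fin m → Fin d → ℤ) : IsC2 (torusChar k) := by
  change ContDiff ℝ 2 fun y : Fin m → Fin d → ℝ =>
    ∏ n, ∏ a, fourier (k n a) ((y n a : ℝ) : UnitAddCircle)
  simp_rw [fourier_coe_apply]
  refine contDiff_prod fun n _ => contDiff_prod fun a _ => ContDiff.cexp ?_
  have : ContDiff ℝ 2 fun y : Fin m → Fin d → ℝ => ((y n a : ℝ) : ℂ) :=
    Complex.ofRealCLM.contDiff.comp (contDiff_apply_apply ℝ ℝ n a)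
  exact (contDiff_const.mul this).div_const _

/-- The kinetic energy `-½Δ` on `C²` functions. -/
noncomputable def kineticTerm (f : Config m d → ℂ) (x : Config m d) : ℂ :=
  -(1 / 2 : ℂ) * ∑ n : Fin m, laplacianIn n f x

lemma continuous_partialDeriv_partialDeriv {f : Config m d → ℂ} (hf : IsC2 f) (n : Fin m)
    (a : Fin d) : Continuous (partialDeriv n a (partialDeriv n a f)) :=
  continuous_of_lift (contDiff_partialDeriv (r := 0)
    (contDiff_partialDeriv (r := 1) hf n a) n a).continuous

lemma continuous_kineticTerm {f : Config m d → ℂ} (hf : IsC2 f) : Continuous (kineticTerm f) := by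
  have h : kineticTerm f =
      fun x => -(1 / 2 : ℂ) * ∑ n, ∑ a, partialDeriv n a (partialDeriv n a f) x := by
    funext x
    simp only [kineticTerm, laplacianIn_eq hf]
  rw [h]
  exact continuous_const.mul (continuous_finsetSum _ fun n _ => continuous_finsetSum _ fun a _ =>
    continuous_partialDeriv_partialDeriv hf n a)

/-- Each second derivative multiplies the Fourier coefficient by (2πi k)² in its direction, by two
applications of the first-order formula. This is the coordinate form of the domain condition used
for the diagonal group. -/
lemma inner_torusBasis_kineticTerm {f : Config m d → ℂ} (hf : IsC2 f) (k : Fin m → Fin d → ℤ) :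
    ⟪torusBasis m d k, toL2 (kineticTerm f)⟫_ℂ =
      freqEnergy k * ⟪torusBasis m d k, toL2 f⟫_ℂ := by
  have hc := continuous_partialDeriv_partialDeriv hf
  have h : kineticTerm f =
      fun x => -(1 / 2 : ℂ) * ∑ n, ∑ a, partialDeriv n a (partialDeriv n a f) x := by
    funext x
    simp only [kineticTerm, laplacianIn_eq hf]
  have hD : ∀ n a, ⟪torusBasis m d k, toL2 (partialDeriv n a (partialDeriv n a f))⟫_ℂ =
      -(2 * Real.pi * k n a) ^ 2 * ⟪torusBasis m d k, toL2 f⟫_ℂ := fun n a => by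
    have h1 : ContDiff ℝ 1 (partialDeriv n a f ∘ torusCover) :=
      contDiff_partialDeriv (r := 1) hf n a
    have h1c : Continuous (partialDeriv n a f) := continuous_of_lift h1.continuous
    rw [torusBasis_apply, inner_toL2 (torusChar k).continuous (hc n a),
      inner_toL2 (torusChar k).continuous hf.continuous,
      integral_deriv_mul_conj_torusChar h1c (hc n a)
        (hasDerivAt_partialDeriv (h1.differentiable (by simp)) n a) k,
      integral_deriv_mul_conj_torusChar hf.continuous h1c
        (hasDerivAt_partialDeriv (ContDiff.differentiable hf (by simp)) n a) k]
    linear_combination ((2 * Real.pi * k n a) ^ 2 * ∫ x, f x * conj (torusChar k x)) *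
      Complex.I_sq
  rw [h, toL2_const_mul (continuous_finsetSum _ fun n _ => continuous_finsetSum _ fun a _ => hc n a),
    toL2_sum _ (fun n => continuous_finsetSum _ fun a _ => hc n a), inner_smul_right, inner_sum]
  simp_rw [toL2_sum _ (fun a => hc _ a), inner_sum, hD, ← Finset.sum_mul]
  rw [freqEnergy]
  push_cast
  rw [← mul_assoc, Finset.mul_sum]
  congr 1
  refine Finset.sum_congr rfl fun n _ => ?_
  rw [Finset.mul_sum]
  exact Finset.sum_congr rfl fun a _ => by ring

lemma toL2_ofReal_mul (V : C(Config m d, ℝ)) {f : Config m d → ℂ} (hf : Continuous f) :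
    toL2 (fun x => (V x : ℂ) * f x) = mulOp volume V (toL2 f) := by
  apply Lp.ext
  refine (coeFn_toL2 ((Complex.continuous_ofReal.comp V.continuous).mul hf)).trans ?_
  filter_upwards [coeFn_mulOp V (toL2 f), coeFn_toL2 hf] with x h1 h2
  rw [h1, h2]
  rfl

lemma toL2_hamiltonian (V : C(Config m d, ℝ)) {f : Config m d → ℂ} (hf : IsC2 f) :
    toL2 (hamiltonian V f) = toL2 (kineticTerm f) + mulOp volume V (toL2 f) := by
  rw [← toL2_ofReal_mul V hf.continuous]
  exact toL2_add (continuous_kineticTerm hf)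
    ((Complex.continuous_ofReal.comp V.continuous).mul hf.continuous)

end DirectionalDerivatives

section SchrodingerGroup

variable {m d : ℕ}

/-- The unitary group `e^{-iHt}` constructed in the interaction picture. -/
noncomputable def torusGroup (V : C(Config m d, ℝ)) : ℝ → L2 m d →L[ℂ] L2 m d :=
  perturbedGroup (torusBasis m d) freqEnergy (inner_mulOp (μ := volume) V)

lemma isSchrodingerGroup_torusGroup (V : C(Config m d, ℝ)) :
    IsSchrodingerGroup V (torusGroup V) where
  norm_map := norm_perturbedGroup _ _ _
  zero := perturbedGroup_zero _ _ _
  add := perturbedGroup_add _ _ _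
  continuous := continuous_perturbedGroup _ _ _
  generator f hf := by
    rw [toL2_hamiltonian V hf]
    exact hasDerivAt_perturbedGroup_zero _ _ _ (inner_torusBasis_kineticTerm hf)

/-- The characters are C², so the generator property is available on them, and their Fourier
coefficients show that they are eigenvectors of the kinetic term. Uniqueness of the perturbed group
needs no more. -/
lemma IsSchrodingerGroup.eq_torusGroup {V : C(Config m d, ℝ)} {U : ℝ → L2 m d →L[ℂ] L2 m d}
    (hU : IsSchrodingerGroup V U) : U = torusGroup V := by
  refine eq_perturbedGroup _ _ _ hU.norm_map hU.zero hU.add hU.continuous fun k => ?_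
  have h := hU.generator (torusChar k) (isC2_torusChar k)
  rw [toL2_hamiltonian V (isC2_torusChar k), ← torusBasis_apply] at h
  convert! h using 4
  refine (torusBasis m d).ext_inner fun j => ?_
  classical
  rw [inner_torusBasis_kineticTerm (isC2_torusChar k), ← torusBasis_apply, inner_smul_right,
    orthonormal_iff_ite.1 (torusBasis m d).orthonormal]
  split_ifs with hjk
  · rw [hjk]
  · simp

lemma schrodingerGroup_eq (V : C(Config m d, ℝ)) : schrodingerGroup V = torusGroup V :=
  IsSchrodingerGroup.eq_torusGroup
    (Classical.epsilon_spec (p := IsSchrodingerGroup V) ⟨_, isSchrodingerGroup_torusGroup V⟩)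

end SchrodingerGroup

/-! ### Tensor products and exchange of components on the doubled torus -/

section TensorProduct

variable {m d : ℕ}

/-- The Hilbert space `L²(𝕋^{md} × 𝕋^{md})`. -/
abbrev L2Prod (m d : ℕ) : Type := Lp ℂ 2 (volume : Measure (Config m d × Config m d))

lemma memLp_tensor {f g : Config m d → ℂ} (hf : MemLp f 2 volume) (hg : MemLp g 2 volume) :
    MemLp (fun z : Config m d × Config m d => f z.1 * g z.2) 2 volume := by
  have hm : AEStronglyMeasurable (fun z : Config m d × Config m d => f z.1 * g z.2) volume :=
    hf.1.comp_fst.mul hg.1.comp_snd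
  rw [memLp_two_iff_integrable_sq_norm hm]
  simp_rw [norm_mul, mul_pow]
  exact ((memLp_two_iff_integrable_sq_norm hf.1).1 hf).mul_prod
    ((memLp_two_iff_integrable_sq_norm hg.1).1 hg)

/-- The tensor product `f ⊗ g` of two square-integrable functions. -/
noncomputable def tensorVec (f g : L2 m d) : L2Prod m d :=
  (memLp_tensor (Lp.memLp f) (Lp.memLp g)).toLp _

lemma coeFn_tensorVec (f g : L2 m d) :
    tensorVec f g =ᵐ[volume] fun z => f z.1 * g z.2 := MemLp.coeFn_toLp _

lemma ae_fst {p : Config m d → Prop} (h : ∀ᵐ x, p x) :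
    ∀ᵐ z : Config m d × Config m d, p z.1 :=
  Measure.quasiMeasurePreserving_fst.ae h

lemma ae_snd {p : Config m d → Prop} (h : ∀ᵐ x, p x) :
    ∀ᵐ z : Config m d × Config m d, p z.2 :=
  Measure.quasiMeasurePreserving_snd.ae h

lemma inner_tensorVec (f g f' g' : L2 m d) :
    ⟪tensorVec f g, tensorVec f' g'⟫_ℂ = ⟪f, f'⟫_ℂ * ⟪g, g'⟫_ℂ := by
  rw [L2.inner_def, L2.inner_def, L2.inner_def, ← integral_prod_mul]
  refine integral_congr_ae ?_
  filter_upwards [coeFn_tensorVec f g, coeFn_tensorVec f' g'] with z h1 h2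
  rw [h1, h2]
  simp only [RCLike.inner_apply, map_mul]
  ring

lemma norm_tensorVec (f g : L2 m d) : ‖tensorVec f g‖ = ‖f‖ * ‖g‖ := by
  have h := inner_tensorVec f g f g
  simp only [inner_self_eq_norm_sq_to_K] at h
  rw [← mul_pow] at h
  have h2 : ‖tensorVec f g‖ ^ 2 = (‖f‖ * ‖g‖) ^ 2 := by exact_mod_cast h
  exact (pow_left_inj₀ (norm_nonneg _) (by positivity) two_ne_zero).1 h2

/-- The tensor product as a bounded bilinear map. -/
noncomputable def tensorL (m d : ℕ) : L2 m d →L[ℂ] L2 m d →L[ℂ] L2Prod m d :=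
  LinearMap.mkContinuous₂
    (LinearMap.mk₂ ℂ tensorVec
      (fun f f' g => by
        apply Lp.ext
        filter_upwards [coeFn_tensorVec (f + f') g, coeFn_tensorVec f g, coeFn_tensorVec f' g,
          Lp.coeFn_add (tensorVec f g) (tensorVec f' g), ae_fst (Lp.coeFn_add f f')]
          with z h1 h2 h3 h4 h5
        rw [h1, h4, Pi.add_apply, h2, h3, h5, Pi.add_apply, add_mul])
      (fun c f g => by
        apply Lp.ext
        filter_upwards [coeFn_tensorVec (c • f) g, coeFn_tensorVec f g,
          Lp.coeFn_smul c (tensorVec f g), ae_fst (Lp.coeFn_smul c f)]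
          with z h1 h2 h3 h4
        rw [h1, h3, Pi.smul_apply, h2, h4, Pi.smul_apply, smul_mul_assoc])
      (fun f g g' => by
        apply Lp.ext
        filter_upwards [coeFn_tensorVec f (g + g'), coeFn_tensorVec f g, coeFn_tensorVec f g',
          Lp.coeFn_add (tensorVec f g) (tensorVec f g'), ae_snd (Lp.coeFn_add g g')]
          with z h1 h2 h3 h4 h5
        rw [h1, h4, Pi.add_apply, h2, h3, h5, Pi.add_apply, mul_add])
      (fun c f g => by
        apply Lp.ext
        filter_upwards [coeFn_tensorVec f (c • g), coeFn_tensorVec f g,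
          Lp.coeFn_smul c (tensorVec f g), ae_snd (Lp.coeFn_smul c g)]
          with z h1 h2 h3 h4
        rw [h1, h3, Pi.smul_apply, h2, h4, Pi.smul_apply, mul_smul_comm]))
    1 (fun f g => by rw [one_mul]; exact (norm_tensorVec f g).le)

lemma tensorL_apply (f g : L2 m d) : tensorL m d f g = tensorVec f g := rfl

lemma coeFn_tensorVec_toL2 {f g : Config m d → ℂ} (hf : Continuous f) (hg : Continuous g) :
    tensorVec (toL2 f) (toL2 g) =ᵐ[volume] fun z => f z.1 * g z.2 := by
  filter_upwards [coeFn_tensorVec (toL2 f) (toL2 g), ae_fst (coeFn_toL2 hf),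
    ae_snd (coeFn_toL2 hg)] with z h1 h2 h3
  rw [h1, h2, h3]

end TensorProduct

section Exchange

variable {m d : ℕ}

/-- The exchange `(x, y) ↦ (x_{*i}, x_{*(1-i)})` of the components selected by `i`. -/
def exchange (i : Fin m → Fin 2) (z : Config m d × Config m d) : Config m d × Config m d :=
  (pick i z.1 z.2, pick (fun n => 1 - i n) z.1 z.2)

lemma one_sub_eq_zero_iff (k : Fin 2) : 1 - k = 0 ↔ ¬ k = 0 := by
  fin_cases k <;> simp

/-- After regrouping a pair of configurations as a family of pairs, the map acts in each factor
separately, by the identity or by the swap. -/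
lemma measurePreserving_exchange (i : Fin m → Fin 2) :
    MeasurePreserving (exchange i : Config m d × Config m d → Config m d × Config m d) := by
  have he := volume_measurePreserving_arrowProdEquivProdArrow (Torus d) (Torus d) (Fin m)
  have hs : MeasurePreserving (fun (u : Fin m → Torus d × Torus d) n =>
      (if i n = 0 then id else Prod.swap) (u n)) volume volume :=
    volume_preserving_pi fun n => by
      split_ifs
      · exact MeasurePreserving.id _
      · exact Measure.measurePreserving_swap
  have heq : (exchange i : Config m d × Config m d → Config m d × Config m d) =
      (MeasurableEquiv.arrowProdEquivProdArrow (Torus d) (Torus d) (Fin m) ∘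
        (fun (u : Fin m → Torus d × Torus d) n => (if i n = 0 then id else Prod.swap) (u n))) ∘
        (MeasurableEquiv.arrowProdEquivProdArrow (Torus d) (Torus d) (Fin m)).symm := by
    funext z
    refine Prod.ext (funext fun n => ?_) (funext fun n => ?_)
    · change (if i n = 0 then z.1 n else z.2 n) =
        ((if i n = 0 then id else Prod.swap) (z.1 n, z.2 n)).1
      split_ifs <;> rfl
    · change (if 1 - i n = 0 then z.1 n else z.2 n) =
        ((if i n = 0 then id else Prod.swap) (z.1 n, z.2 n)).2
      simp only [one_sub_eq_zero_iff]
      split_ifs <;> rfl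
  rw [heq]
  exact (he.comp hs).comp (he.symm _)

lemma continuous_pick (i : Fin m → Fin 2) :
    Continuous fun z : Config m d × Config m d => pick i z.1 z.2 := by
  refine continuous_pi fun n => ?_
  by_cases h : i n = 0
  · simp only [pick, h, if_true]; fun_prop
  · simp only [pick, h, if_false]; fun_prop

/-- The unitary operator on `L²(𝕋^{md} × 𝕋^{md})` exchanging the components selected by `i`. -/
noncomputable def exchangeOp (i : Fin m → Fin 2) : L2Prod m d →ₗᵢ[ℂ] L2Prod m d :=
  Lp.compMeasurePreservingₗᵢ ℂ (exchange i) (measurePreserving_exchange i)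

lemma coeFn_exchangeOp (i : Fin m → Fin 2) (F : L2Prod m d) :
    exchangeOp i F =ᵐ[volume] fun z => F (exchange i z) :=
  Lp.coeFn_compMeasurePreserving F (measurePreserving_exchange i)

lemma coeFn_exchangeOp_of_ae {i : Fin m → Fin 2} {F : L2Prod m d}
    {G : Config m d × Config m d → ℂ} (h : F =ᵐ[volume] G) :
    exchangeOp i F =ᵐ[volume] fun z => G (exchange i z) :=
  (coeFn_exchangeOp i F).trans
    ((measurePreserving_exchange i).quasiMeasurePreserving.ae_eq_comp h)

/-- The frequency with components `p_n` or `q_n` as selected by `i`. -/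
def pickFreq (i : Fin m → Fin 2) (p q : Fin m → Fin d → ℤ) : Fin m → Fin d → ℤ :=
  fun n => if i n = 0 then p n else q n

lemma torusChar_pick_mul (i : Fin m → Fin 2) (p q : Fin m → Fin d → ℤ) (x y : Config m d) :
    torusChar p (pick i x y) * torusChar q (pick (fun n => 1 - i n) x y) =
      torusChar (pickFreq i p q) x * torusChar (pickFreq i q p) y := by
  simp only [torusChar_apply, ← Finset.prod_mul_distrib]
  refine Finset.prod_congr rfl fun n _ => Finset.prod_congr rfl fun a _ => ?_
  simp only [pick, pickFreq, one_sub_eq_zero_iff]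
  by_cases h : i n = 0
  · simp [h]
  · simp [h, mul_comm]

/-- The kinetic energy is a sum over components, and the exchange only redistributes components
between the two copies. This is why the free evolution commutes with the exchange. -/
lemma freqEnergy_pickFreq (i : Fin m → Fin 2) (p q : Fin m → Fin d → ℤ) :
    freqEnergy (pickFreq i p q) + freqEnergy (pickFreq i q p) = freqEnergy p + freqEnergy q := by
  simp only [freqEnergy, ← Finset.sum_add_distrib]
  refine Finset.sum_congr rfl fun n _ => Finset.sum_congr rfl fun a _ => ?_
  by_cases h : i n = 0
  · simp [pickFreq, h]
  · simp [pickFreq, h, add_comm]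

lemma exchangeOp_tensorVec_basis (i : Fin m → Fin 2) (p q : Fin m → Fin d → ℤ) :
    exchangeOp i (tensorVec (torusBasis m d p) (torusBasis m d q)) =
      tensorVec (torusBasis m d (pickFreq i p q)) (torusBasis m d (pickFreq i q p)) := by
  simp only [torusBasis_apply]
  apply Lp.ext
  filter_upwards [coeFn_exchangeOp_of_ae (i := i)
    (coeFn_tensorVec_toL2 (torusChar p).continuous (torusChar q).continuous),
    coeFn_tensorVec_toL2 (torusChar (pickFreq i p q)).continuous
      (torusChar (pickFreq i q p)).continuous] with z h1 h2
  rw [h1, h2]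
  exact torusChar_pick_mul i p q z.1 z.2

end Exchange

/-! ### Invariance of the exchange form under the Schrödinger group -/

section ExchangeForm

variable {m d : ℕ}

/-- The form `⟨e ⊗ g, S_i (f ⊗ h)⟩`, where `S_i` is the exchange operator. -/
noncomputable def exchangeForm (i : Fin m → Fin 2) (e g f h : L2 m d) : ℂ :=
  ⟪tensorVec e g, exchangeOp i (tensorVec f h)⟫_ℂ

/-- The free evolution preserves the exchange form. -/
lemma exchangeForm_diagGroup (i : Fin m → Fin 2) (t : ℝ) (e g f h : L2 m d) :
    exchangeForm i (diagGroup (torusBasis m d) freqEnergy t e)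
      (diagGroup (torusBasis m d) freqEnergy t g) (diagGroup (torusBasis m d) freqEnergy t f)
      (diagGroup (torusBasis m d) freqEnergy t h) = exchangeForm i e g f h := by
  set D := diagGroup (torusBasis m d) freqEnergy t with hD
  -- On characters the exchange yields characters with the same total energy, hence the same total
  -- phase. The phase is redistributed onto the new pair, the form factors into two inner products,
  -- and D is unitary in each.
  have hbasis : ∀ p q, exchangeForm i (D e) (D g) (D (torusBasis m d p)) (D (torusBasis m d q)) =
      exchangeForm i e g (torusBasis m d p) (torusBasis m d q) := fun p q => by
    have hS : exchangeOp i (tensorVec (D (torusBasis m d p)) (D (torusBasis m d q))) =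
        tensorVec (D (torusBasis m d (pickFreq i p q)))
          (D (torusBasis m d (pickFreq i q p))) := by
      simp only [hD, diagGroup_basis, ← tensorL_apply, map_smul, smul_apply,
        smul_smul]
      simp only [tensorL_apply, exchangeOp_tensorVec_basis]
      congr 1
      simp only [phase, ← Complex.exp_add]
      congr 1
      have := congrArg (fun r : ℝ => (r : ℂ)) (freqEnergy_pickFreq i p q)
      simp only [Complex.ofReal_add] at this
      linear_combination (Complex.I * t) * this
    rw [exchangeForm, hS, exchangeForm, exchangeOp_tensorVec_basis, inner_tensorVec,
      inner_tensorVec, hD, inner_diagGroup, inner_diagGroup]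
  -- The form is linear and continuous in f and in h, so the identity extends from basis vectors in
  -- one slot at a time.
  have h1 : ∀ q, exchangeForm i (D e) (D g) (D f) (D (torusBasis m d q)) =
      exchangeForm i e g f (torusBasis m d q) := fun q => by
    have := (torusBasis m d).clm_ext
      (f := (innerSL ℂ (tensorVec (D e) (D g))).comp ((exchangeOp i).toContinuousLinearMap.comp
        (((tensorL m d).flip (D (torusBasis m d q))).comp D)))
      (g := (innerSL ℂ (tensorVec e g)).comp ((exchangeOp i).toContinuousLinearMap.comp
        ((tensorL m d).flip (torusBasis m d q)))) (fun p => hbasis p q)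
    exact DFunLike.congr_fun this f
  have := (torusBasis m d).clm_ext
    (f := (innerSL ℂ (tensorVec (D e) (D g))).comp ((exchangeOp i).toContinuousLinearMap.comp
      ((tensorL m d (D f)).comp D)))
    (g := (innerSL ℂ (tensorVec e g)).comp ((exchangeOp i).toContinuousLinearMap.comp
      (tensorL m d f))) (fun q => h1 q)
  exact DFunLike.congr_fun this h

/-- The potential `V(x) + V(y)` on the doubled torus. -/
noncomputable def doubledPotential (V : C(Config m d, ℝ)) : C(Config m d × Config m d, ℝ) where
  toFun z := V z.1 + V z.2

lemma tensorVec_mulOp_add (V : C(Config m d, ℝ)) (f g : L2 m d) :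
    tensorVec (mulOp volume V f) g + tensorVec f (mulOp volume V g) =
      mulOp volume (doubledPotential V) (tensorVec f g) := by
  apply Lp.ext
  filter_upwards [Lp.coeFn_add (tensorVec (mulOp volume V f) g) (tensorVec f (mulOp volume V g)),
    coeFn_tensorVec (mulOp volume V f) g, coeFn_tensorVec f (mulOp volume V g),
    coeFn_mulOp (doubledPotential V) (tensorVec f g), coeFn_tensorVec f g,
    ae_fst (coeFn_mulOp V f), ae_snd (coeFn_mulOp V g)] with z h1 h2 h3 h4 h5 h6 h7
  rw [h1, Pi.add_apply, h2, h3, h4, h5, h6, h7]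
  simp only [doubledPotential, ContinuousMap.coe_mk, Complex.ofReal_add]
  ring

/-- The potential is additive with respect to the exchange of the components selected by `i`. -/
def ExchangeInvariant (i : Fin m → Fin 2) (V : Config m d → ℝ) : Prop :=
  ∀ x y, V (pick i x y) + V (pick (fun n => 1 - i n) x y) = V x + V y

lemma exchangeOp_mulOp {i : Fin m → Fin 2} {V : C(Config m d, ℝ)} (hV : ExchangeInvariant i V)
    (F : L2Prod m d) : exchangeOp i (mulOp volume (doubledPotential V) F) =
      mulOp volume (doubledPotential V) (exchangeOp i F) := by
  apply Lp.ext
  filter_upwards [coeFn_exchangeOp_of_ae (i := i) (coeFn_mulOp (doubledPotential V) F),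
    coeFn_mulOp (doubledPotential V) (exchangeOp i F), coeFn_exchangeOp i F] with z h1 h2 h3
  rw [h1, h2, h3]
  congr 2
  exact hV z.1 z.2

/-- The multiplication by V(x) + V(y) is symmetric and commutes with the exchange. This is the
infinitesimal form of invariance under the potential part of the evolution. -/
lemma exchangeForm_mulOp {i : Fin m → Fin 2} {V : C(Config m d, ℝ)} (hV : ExchangeInvariant i V)
    (e g f h : L2 m d) :
    exchangeForm i (mulOp volume V e) g f h + exchangeForm i e (mulOp volume V g) f h =
      exchangeForm i e g (mulOp volume V f) h + exchangeForm i e g f (mulOp volume V h) := by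
  simp only [exchangeForm]
  rw [← inner_add_left, ← inner_add_right, ← map_add, tensorVec_mulOp_add, tensorVec_mulOp_add,
    inner_mulOp, exchangeOp_mulOp hV]

lemma hasDerivAt_exchangeForm (i : Fin m → Fin 2) {e g f h : ℝ → L2 m d} {e' g' f' h' : L2 m d}
    {t : ℝ} (he : HasDerivAt e e' t) (hg : HasDerivAt g g' t) (hf : HasDerivAt f f' t)
    (hh : HasDerivAt h h' t) :
    HasDerivAt (fun s => exchangeForm i (e s) (g s) (f s) (h s))
      (exchangeForm i (e t) (g t) (f t) h' + exchangeForm i (e t) (g t) f' (h t) +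
        (exchangeForm i (e t) g' (f t) (h t) + exchangeForm i e' (g t) (f t) (h t))) t := by
  have hJ : ∀ {u v : ℝ → L2 m d} {u' v' : L2 m d}, HasDerivAt u u' t → HasDerivAt v v' t →
      HasDerivAt (fun s => tensorVec (u s) (v s))
        (tensorVec (u t) v' + tensorVec u' (v t)) t := fun hu hv =>
    ((tensorL m d).bilinearRestrictScalars ℝ).hasDerivAt_of_bilinear (fun _ => hu) (fun _ => hv)
  have hS := ((exchangeOp (d := d) i).toContinuousLinearMap.restrictScalars
    ℝ).hasFDerivAt.comp_hasDerivAt t (hJ hf hh)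
  refine ((hJ he hg).inner ℂ hS).congr_deriv ?_
  simp only [exchangeForm, ← inner_add_left, ← inner_add_right, ← map_add]
  rfl

/-- The Schrödinger evolution preserves the exchange form. -/
lemma exchangeForm_torusGroup {i : Fin m → Fin 2} {V : C(Config m d, ℝ)}
    (hV : ExchangeInvariant i V) (t : ℝ) (e g f h : L2 m d) :
    exchangeForm i (torusGroup V t e) (torusGroup V t g) (torusGroup V t f) (torusGroup V t h) =
      exchangeForm i e g f h := by
  have hA := inner_mulOp (μ := (volume : Measure (Config m d))) V
  set w := interactionCurve (torusBasis m d) freqEnergy (mulOp volume V) with hw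
  have hd : ∀ s, HasDerivAt (fun s => exchangeForm i (w e s) (w g s) (w f s) (w h s)) 0 s := by
    intro s
    have hws := fun F => hasDerivAt_interactionCurve (torusBasis m d) freqEnergy
      (mulOp volume V) F s
    refine (hasDerivAt_exchangeForm i (hws e) (hws g) (hws f) (hws h)).congr_deriv ?_
    -- D(s) is inserted into all four slots of each of the four terms. It turns the interaction
    -- generator into -iA acting on D(s) w(s), where A is multiplication by V.
    rw [← exchangeForm_diagGroup i s, ← exchangeForm_diagGroup i s (w e s) (w g s),
      ← exchangeForm_diagGroup i s (w e s), ← exchangeForm_diagGroup i s _ (w g s)]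
    simp only [interactionGenerator_apply, map_smul, diagGroup_self_neg]
    have hV' := exchangeForm_mulOp hV (diagGroup (torusBasis m d) freqEnergy s (w e s))
      (diagGroup (torusBasis m d) freqEnergy s (w g s))
      (diagGroup (torusBasis m d) freqEnergy s (w f s))
      (diagGroup (torusBasis m d) freqEnergy s (w h s))
    simp only [exchangeForm, ← tensorL_apply, map_smul, smul_apply,
      inner_smul_left, inner_smul_right, map_neg, Complex.conj_I] at hV' ⊢
    -- The slots e and g are conjugate-linear, so they contribute +i against -i from f and h; the
    -- potential identity cancels the total.
    linear_combination Complex.I * hV'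
  have hc := is_const_of_deriv_eq_zero (fun s => (hd s).differentiableAt) (fun s => (hd s).deriv) t 0
  have ht : ∀ F, torusGroup V t F = diagGroup (torusBasis m d) freqEnergy t (w F t) :=
    fun F => rfl
  simp only [hw, interactionCurve_zero] at hc
  rw [ht, ht, ht, ht, exchangeForm_diagGroup, hw]
  exact hc

end ExchangeForm

/-! ### The cubic interaction as a bounded trilinear expression on L² -/

section TripleProduct

variable {m d : ℕ}

/-- The trilinear interaction `∫ f(x_{*i}) conj(g(x_{*1})) h(x_{*(1-i)}) dx_{*1}`, extended to
square-integrable functions by duality. -/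
noncomputable def tripleProduct (i : Fin m → Fin 2) (f g h : L2 m d) : L2 m d :=
  ContinuousLinearMap.adjoint ((tensorL m d).flip g) (exchangeOp i (tensorVec f h))

lemma inner_tripleProduct (i : Fin m → Fin 2) (e f g h : L2 m d) :
    ⟪e, tripleProduct i f g h⟫_ℂ = exchangeForm i e g f h :=
  ContinuousLinearMap.adjoint_inner_right _ _ _

/-- Pairing the vector with itself gives an exchange form, to which Cauchy–Schwarz applies; one
factor of the norm is then divided out. -/
lemma norm_tripleProduct_le (i : Fin m → Fin 2) (f g h : L2 m d) :
    ‖tripleProduct i f g h‖ ≤ ‖f‖ * ‖g‖ * ‖h‖ := by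
  by_cases h0 : ‖tripleProduct i f g h‖ = 0
  · rw [h0]; positivity
  have h1 : ‖tripleProduct i f g h‖ * ‖tripleProduct i f g h‖ ≤
      ‖tripleProduct i f g h‖ * (‖f‖ * ‖g‖ * ‖h‖) := by
    calc ‖tripleProduct i f g h‖ * ‖tripleProduct i f g h‖
        = ‖⟪tripleProduct i f g h, tripleProduct i f g h⟫_ℂ‖ := by
          rw [inner_self_eq_norm_sq_to_K]; simp [sq]
      _ = ‖exchangeForm i (tripleProduct i f g h) g f h‖ := by rw [inner_tripleProduct]
      _ ≤ ‖tensorVec (tripleProduct i f g h) g‖ * ‖exchangeOp i (tensorVec f h)‖ :=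
          norm_inner_le_norm _ _
      _ = _ := by rw [LinearIsometry.norm_map, norm_tensorVec, norm_tensorVec]; ring
  exact le_of_mul_le_mul_left h1 (lt_of_le_of_ne (norm_nonneg _) (Ne.symm h0))

/-- Telescoping, one argument changed at a time; additivity in each slot is read off from the form.
-/
lemma tripleProduct_sub (i : Fin m → Fin 2) (f g h f' g' h' : L2 m d) :
    tripleProduct i f g h - tripleProduct i f' g' h' =
      tripleProduct i (f - f') g h + tripleProduct i f' (g - g') h +
        tripleProduct i f' g' (h - h') := by
  refine (torusBasis m d).ext_inner fun k => ?_
  simp only [inner_sub_right, inner_add_right, inner_tripleProduct]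
  simp only [exchangeForm, ← tensorL_apply, map_sub, sub_apply,
    inner_sub_left, inner_sub_right]
  ring

/-- By unitarity every test vector is of the form U(t) e, and the pairing with it is the invariant
exchange form. -/
lemma torusGroup_tripleProduct {i : Fin m → Fin 2} {V : C(Config m d, ℝ)}
    (hV : ExchangeInvariant i V) (t : ℝ) (f g h : L2 m d) :
    torusGroup V t (tripleProduct i f g h) =
      tripleProduct i (torusGroup V t f) (torusGroup V t g) (torusGroup V t h) := by
  have hU := isSchrodingerGroup_torusGroup V
  refine ext_inner_left ℂ fun e => ?_
  have he : e = torusGroup V t (torusGroup V (-t) e) := by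
    rw [← ContinuousLinearMap.comp_apply, ← hU.add, add_neg_cancel, hU.zero]; rfl
  rw [he, inner_tripleProduct, exchangeForm_torusGroup hV, ← inner_tripleProduct]
  exact LinearIsometry.inner_map_map ⟨(torusGroup V t).toLinearMap, hU.norm_map t⟩ _ _

lemma continuous_integrand (i : Fin m → Fin 2) {f g h : Config m d → ℂ} (hf : Continuous f)
    (hg : Continuous g) (hh : Continuous h) : Continuous fun z : Config m d × Config m d =>
      f (pick i z.1 z.2) * conj (g z.2) * h (pick (fun n => 1 - i n) z.1 z.2) :=
  ((hf.comp (continuous_pick i)).mul (Complex.continuous_conj.comp (hg.comp continuous_snd))).mul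
    (hh.comp (continuous_pick _))

lemma continuous_parametric_integral_torus {F : Config m d × Config m d → ℂ}
    (hF : Continuous F) : Continuous fun x => ∫ y, F (x, y) := by
  have := continuous_parametric_integral_of_continuous (μ := (volume : Measure (Config m d)))
    (f := fun x y => F (x, y)) hF isCompact_univ
  simpa using this

/-- Fubini: tested against a character, the iterated integral is the integral over the doubled torus
that defines the exchange form. -/
lemma toL2_tripleProduct (i : Fin m → Fin 2) {f g h : Config m d → ℂ} (hf : Continuous f)
    (hg : Continuous g) (hh : Continuous h) :
    toL2 (fun x => ∫ y, f (pick i x y) * conj (g y) * h (pick (fun n => 1 - i n) x y)) =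
      tripleProduct i (toL2 f) (toL2 g) (toL2 h) := by
  refine (torusBasis m d).ext_inner fun k => ?_
  have hc := continuous_integrand i hf hg hh
  rw [inner_tripleProduct, torusBasis_apply, inner_toL2 (torusChar k).continuous
    (continuous_parametric_integral_torus hc), exchangeForm, L2.inner_def]
  have hint : Continuous fun z : Config m d × Config m d =>
      f (pick i z.1 z.2) * conj (g z.2) * h (pick (fun n => 1 - i n) z.1 z.2) *
        conj (torusChar k z.1) :=
    hc.mul (Complex.continuous_conj.comp ((torusChar k).continuous.comp continuous_fst))
  have hprod := integral_prod (μ := (volume : Measure (Config m d)))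
    (ν := (volume : Measure (Config m d))) _
    ((hint.memLp_of_hasCompactSupport (p := 1)
      (HasCompactSupport.of_compactSpace _)).integrable le_rfl)
  simp only [integral_mul_const] at hprod
  rw [← hprod]
  refine integral_congr_ae ?_
  filter_upwards [coeFn_tensorVec_toL2 (torusChar k).continuous hg,
    coeFn_exchangeOp_of_ae (i := i) (coeFn_tensorVec_toL2 hf hh)] with z h1 h2
  rw [h1, h2]
  simp only [RCLike.inner_apply, map_mul, exchange]
  ring

end TripleProduct

/-! ### From pointwise time derivatives to curves in L² -/

section TimeRegularity

variable {m d : ℕ}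

lemma continuous_slice {f : ℝ → Config m d → ℂ} {s : Set ℝ}
    (hf : ContinuousOn (fun p : ℝ × Config m d => f p.1 p.2) (s ×ˢ Set.univ)) {t : ℝ}
    (ht : t ∈ s) : Continuous (f t) :=
  hf.comp_continuous (continuous_const.prodMk continuous_id) fun _ => ⟨ht, trivial⟩

open Classical in
/-- A function of the torus as an element of the space of continuous functions. -/
noncomputable def continuousMapOf (f : Config m d → ℂ) : C(Config m d, ℂ) :=
  if h : Continuous f then ⟨f, h⟩ else 0

lemma continuousMapOf_apply {f : Config m d → ℂ} (hf : Continuous f) (x : Config m d) :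
    continuousMapOf f x = f x := by
  rw [continuousMapOf, dif_pos hf]; rfl

lemma toL2_eq_toLp {f : Config m d → ℂ} (hf : Continuous f) :
    toL2 f = ContinuousMap.toLp 2 volume ℂ (continuousMapOf f) := by
  rw [← toL2_coe]
  congr 1
  exact funext fun x => (continuousMapOf_apply hf x).symm

lemma continuousOn_continuousMapOf {f : ℝ → Config m d → ℂ} {s : Set ℝ}
    (hf : ContinuousOn (fun p : ℝ × Config m d => f p.1 p.2) (s ×ˢ Set.univ)) :
    ContinuousOn (fun t => continuousMapOf (f t)) s := by
  rw [continuousOn_iff_continuous_domRestrict]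
  refine ContinuousMap.continuous_of_continuous_uncurry _ ?_
  have h : Continuous fun p : s × Config m d => f p.1 p.2 :=
    hf.comp_continuous (f := fun p : s × Config m d => ((p.1 : ℝ), p.2))
      ((continuous_subtype_val.comp continuous_fst).prodMk continuous_snd)
      fun p => ⟨p.1.2, trivial⟩
  convert! h using 1
  funext p
  exact continuousMapOf_apply (continuous_slice hf p.1.2) p.2

lemma continuousOn_toL2 {f : ℝ → Config m d → ℂ} {s : Set ℝ}
    (hf : ContinuousOn (fun p : ℝ × Config m d => f p.1 p.2) (s ×ˢ Set.univ)) :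
    ContinuousOn (fun t => toL2 (f t)) s :=
  ((ContinuousMap.toLp 2 volume ℂ).continuous.comp_continuousOn
    (continuousOn_continuousMapOf hf)).congr fun _ ht => toL2_eq_toLp (continuous_slice hf ht)

/-- A function that is jointly `C¹` in time is a differentiable curve in `L²`. -/
lemma hasDerivAt_toL2 {f f' : ℝ → Config m d → ℂ} {s : Set ℝ} (hs : IsOpen s)
    (hf : ∀ t ∈ s, Continuous (f t))
    (hf' : ContinuousOn (fun p : ℝ × Config m d => f' p.1 p.2) (s ×ˢ Set.univ))
    (hd : ∀ t ∈ s, ∀ x, HasDerivAt (fun r => f r x) (f' t x) t) {t : ℝ} (ht : t ∈ s) :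
    HasDerivAt (fun r => toL2 (f r)) (toL2 (f' t)) t := by
  -- Differentiability is proved in the sup norm. By compactness the time derivative is continuous
  -- into C(𝕋^{md}), so a single δ serves the mean value inequality at all x.
  have key : HasDerivAt (fun r => continuousMapOf (f r)) (continuousMapOf (f' t)) t := by
    rw [hasDerivAt_iff_isLittleO, Asymptotics.isLittleO_iff]
    intro ε hε
    have hc : ContinuousAt (fun r => continuousMapOf (f' r)) t :=
      (continuousOn_continuousMapOf hf').continuousAt (hs.mem_nhds ht)
    obtain ⟨δ, hδ, hball⟩ := Metric.mem_nhds_iff.1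
      (inter_mem (hs.mem_nhds ht) (Metric.tendsto_nhds.1 hc ε hε))
    filter_upwards [Metric.ball_mem_nhds t hδ] with r hr
    refine (ContinuousMap.norm_le _ (by positivity)).2 fun x => ?_
    have hbound := (convex_ball t δ).norm_image_sub_le_of_norm_hasDerivWithin_le
      (f := fun u => f u x - (u - t) • f' t x) (f' := fun u => f' u x - f' t x) (C := ε)
      (fun u hu => by
        have h1 := hd u (hball hu).1 x
        have h2 : HasDerivAt (fun u : ℝ => (u - t) • f' t x) (f' t x) u := by
          simpa using ((hasDerivAt_id u).sub_const t).smul_const (f' t x)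
        exact (h1.sub h2).hasDerivWithinAt)
      (fun u hu => by
        have h1 : dist (continuousMapOf (f' u)) (continuousMapOf (f' t)) < ε := (hball hu).2
        rw [dist_eq_norm] at h1
        have h2 := (continuousMapOf (f' u) - continuousMapOf (f' t)).norm_coe_le_norm x
        rw [ContinuousMap.sub_apply, continuousMapOf_apply (continuous_slice hf' (hball hu).1),
          continuousMapOf_apply (continuous_slice hf' ht)] at h2
        exact h2.trans h1.le)
      (Metric.mem_ball_self hδ) hr
    simp only [ContinuousMap.sub_apply, ContinuousMap.smul_apply]
    rw [continuousMapOf_apply (hf r (hball hr).1), continuousMapOf_apply (hf t ht),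
      continuousMapOf_apply (continuous_slice hf' ht)]
    simp only [sub_self, zero_smul, sub_zero] at hbound
    rw [sub_right_comm]
    exact hbound
  have h2 := ((ContinuousMap.toLp (E := ℂ) 2 (volume : Measure (Config m d)) ℂ).restrictScalars
    ℝ).hasFDerivAt.comp_hasDerivAt t key
  rw [toL2_eq_toLp (continuous_slice hf' ht)]
  refine h2.congr_of_eventuallyEq ?_
  filter_upwards [hs.mem_nhds ht] with r hr
  exact toL2_eq_toLp (hf r hr)

end TimeRegularity

/-! ### Maps Lipschitz on balls and uniqueness for their equations -/

section LipschitzOnBalls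

variable {E F : Type*} [NormedAddCommGroup E] [NormedAddCommGroup F]

/-- Lipschitz continuity on every ball. -/
def LipschitzOnBalls (T : E → F) : Prop :=
  ∀ r : ℝ, ∃ K : ℝ, ∀ x y, ‖x‖ ≤ r → ‖y‖ ≤ r → ‖T x - T y‖ ≤ K * ‖x - y‖

lemma LipschitzOnBalls.continuous {T : E → F} (hT : LipschitzOnBalls T) : Continuous T := by
  refine continuous_iff_continuousAt.2 fun x => ?_
  obtain ⟨K, hK⟩ := hT (‖x‖ + 1)
  rw [ContinuousAt, tendsto_iff_norm_sub_tendsto_zero]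
  have h0 : Tendsto (fun y => K * ‖y - x‖) (𝓝 x) (𝓝 0) := by
    have := (tendsto_iff_norm_sub_tendsto_zero.1 (tendsto_id (x := 𝓝 x))).const_mul K
    simpa using this
  refine squeeze_zero' (Eventually.of_forall fun _ => norm_nonneg _) ?_ h0
  filter_upwards [Metric.ball_mem_nhds x one_pos] with y hy
  refine hK y x ?_ (by linarith)
  have h1 : ‖y - x‖ < 1 := by simpa [dist_eq_norm] using hy
  have h2 := norm_sub_norm_le y x
  linarith

lemma LipschitzOnBalls.add {S T : E → F} (hS : LipschitzOnBalls S) (hT : LipschitzOnBalls T) :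
    LipschitzOnBalls fun x => S x + T x := fun r => by
  obtain ⟨K, hK⟩ := hS r
  obtain ⟨L, hL⟩ := hT r
  refine ⟨K + L, fun x y hx hy => ?_⟩
  rw [add_sub_add_comm, add_mul]
  exact (norm_add_le _ _).trans (add_le_add (hK x y hx hy) (hL x y hx hy))

lemma LipschitzOnBalls.const_smul [NormedSpace ℂ F] {T : E → F} (hT : LipschitzOnBalls T) (c : ℂ) :
    LipschitzOnBalls fun x => c • T x := fun r => by
  obtain ⟨K, hK⟩ := hT r
  refine ⟨‖c‖ * K, fun x y hx hy => ?_⟩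
  rw [← smul_sub, norm_smul, mul_assoc]
  exact mul_le_mul_of_nonneg_left (hK x y hx hy) (norm_nonneg _)

lemma LipschitzOnBalls.sub {S T : E → F} (hS : LipschitzOnBalls S) (hT : LipschitzOnBalls T) :
    LipschitzOnBalls fun x => S x - T x := fun r => by
  obtain ⟨K, hK⟩ := hS r
  obtain ⟨L, hL⟩ := hT r
  refine ⟨K + L, fun x y hx hy => ?_⟩
  rw [sub_sub_sub_comm, add_mul]
  exact (norm_sub_le _ _).trans (add_le_add (hK x y hx hy) (hL x y hx hy))

lemma LipschitzOnBalls.sum {ι : Type*} {T : ι → E → F} (hT : ∀ i, LipschitzOnBalls (T i))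
    (s : Finset ι) : LipschitzOnBalls fun x => ∑ i ∈ s, T i x := by
  classical
  induction s using Finset.induction_on with
  | empty => exact fun r => ⟨0, fun x y _ _ => by simp⟩
  | insert i s hi ih => simpa only [Finset.sum_insert hi] using (hT i).add ih

lemma LipschitzOnBalls.pi {ι : Type*} [Fintype ι] {T : E → ι → F}
    (hT : ∀ i, LipschitzOnBalls fun x => T x i) : LipschitzOnBalls T := fun r => by
  choose K hK using fun i => hT i r
  -- Absolute values are needed because the constants `K i` are not assumed nonnegative.
  refine ⟨∑ i, |K i|, fun x y hx hy => ?_⟩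
  refine (pi_norm_le_iff_of_nonneg (by positivity)).2 fun i => (hK i x y hx hy).trans ?_
  refine mul_le_mul_of_nonneg_right ((le_abs_self _).trans ?_) (norm_nonneg _)
  exact Finset.single_le_sum (f := fun i => |K i|) (fun i _ => abs_nonneg _) (Finset.mem_univ i)

variable [NormedSpace ℝ E]

/-- Uniqueness for an autonomous equation whose solutions are differentiable at positive times
and continuous up to the initial time. -/
lemma LipschitzOnBalls.ode_unique {T : E → E} (hT : LipschitzOnBalls T) {w v : ℝ → E}
    (hw : ContinuousOn w (Set.Ici 0)) (hv : ContinuousOn v (Set.Ici 0))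
    (hw' : ∀ t, 0 < t → HasDerivAt w (T (w t)) t) (hv' : ∀ t, 0 < t → HasDerivAt v (T (v t)) t)
    (h0 : w 0 = v 0) {t : ℝ} (ht : 0 ≤ t) : w t = v t := by
  have hsub : Set.Icc 0 t ⊆ Set.Ici 0 := Set.Icc_subset_Ici_self
  obtain ⟨r₁, hr₁⟩ := isCompact_Icc.exists_bound_of_continuousOn (hw.mono hsub)
  obtain ⟨r₂, hr₂⟩ := isCompact_Icc.exists_bound_of_continuousOn (hv.mono hsub)
  obtain ⟨K, hK⟩ := hT (max r₁ r₂)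
  have hright : ∀ u : ℝ → E, ContinuousOn u (Set.Ici 0) →
      (∀ t, 0 < t → HasDerivAt u (T (u t)) t) → ∀ s ∈ Set.Ico 0 t,
        HasDerivWithinAt u (T (u s)) (Set.Ici s) s := by
    intro u hu hu' s hs
    rcases hs.1.eq_or_lt with rfl | hpos
    -- At time 0 the equation is not assumed; the right derivative exists because the derivatives at
    -- positive times converge to T (u 0).
    · refine hasDerivWithinAt_Ici_of_tendsto_deriv (s := Set.Ioi 0)
        (fun s hs => (hu' s hs).differentiableAt.differentiableWithinAt)
        ((hu 0 Set.self_mem_Ici).mono Set.Ioi_subset_Ici_self) self_mem_nhdsWithin ?_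
      have hlim : Tendsto u (𝓝[>] 0) (𝓝 (u 0)) :=
        (hu 0 Set.self_mem_Ici).mono Set.Ioi_subset_Ici_self
      refine ((hT.continuous.tendsto _).comp hlim).congr' ?_
      filter_upwards [self_mem_nhdsWithin] with s hs
      exact (hu' s hs).deriv.symm
    · exact (hu' s hpos).hasDerivWithinAt
  -- On [0, t] both curves stay in the ball of radius `max r₁ r₂`, where T is Lipschitz.
  refine ODE_solution_unique_of_mem_Icc_right (v := fun _ => T) (K := K.toNNReal)
    (s := fun _ => Metric.closedBall 0 (max r₁ r₂)) (fun s _ => ?_) (hw.mono hsub)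
    (hright w hw hw') (fun s hs => ?_) (hv.mono hsub) (hright v hv hv') (fun s hs => ?_) h0
    ⟨ht, le_rfl⟩
  · refine LipschitzOnWith.of_dist_le_mul fun x hx y hy => ?_
    rw [dist_eq_norm, dist_eq_norm]
    refine (hK x y (by simpa using hx) (by simpa using hy)).trans ?_
    exact mul_le_mul_of_nonneg_right (Real.le_coe_toNNReal K) (norm_nonneg _)
  · simpa using Or.inl (hr₁ s ⟨hs.1, hs.2.le⟩)
  · simpa using Or.inr (hr₂ s ⟨hs.1, hs.2.le⟩)

end LipschitzOnBalls

/-! ### The tensor and matrix interactions on L² -/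

section Interactions

variable {m d N : ℕ}

lemma lipschitzOnBalls_tripleProduct {E : Type*} [NormedAddCommGroup E] [NormedSpace ℂ E]
    (i : Fin m → Fin 2) (a b c : E →L[ℂ] L2 m d) :
    LipschitzOnBalls fun x => tripleProduct i (a x) (b x) (c x) := fun r => by
  refine ⟨3 * (‖a‖ * ‖b‖ * ‖c‖ * r ^ 2), fun x y hx hy => ?_⟩
  have hr : 0 ≤ r := (norm_nonneg _).trans hx
  rw [tripleProduct_sub, ← map_sub, ← map_sub, ← map_sub]
  have hle : ∀ (l : E →L[ℂ] L2 m d) {z : E}, ‖z‖ ≤ r → ‖l z‖ ≤ ‖l‖ * r := fun l z hz =>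
    (l.le_opNorm z).trans (mul_le_mul_of_nonneg_left hz (norm_nonneg _))
  have h1 : ‖tripleProduct i (a (x - y)) (b x) (c x)‖ ≤
      (‖a‖ * ‖x - y‖) * (‖b‖ * r) * (‖c‖ * r) :=
    (norm_tripleProduct_le i _ _ _).trans (by gcongr; exacts [a.le_opNorm _, hle b hx, hle c hx])
  have h2 : ‖tripleProduct i (a y) (b (x - y)) (c x)‖ ≤
      (‖a‖ * r) * (‖b‖ * ‖x - y‖) * (‖c‖ * r) :=
    (norm_tripleProduct_le i _ _ _).trans (by gcongr; exacts [hle a hy, b.le_opNorm _, hle c hx])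
  have h3 : ‖tripleProduct i (a y) (b y) (c (x - y))‖ ≤
      (‖a‖ * r) * (‖b‖ * r) * (‖c‖ * ‖x - y‖) :=
    (norm_tripleProduct_le i _ _ _).trans (by gcongr; exacts [hle a hy, hle b hy, c.le_opNorm _])
  calc _ ≤ (‖a‖ * ‖x - y‖) * (‖b‖ * r) * (‖c‖ * r) + (‖a‖ * r) * (‖b‖ * ‖x - y‖) * (‖c‖ * r) +
        (‖a‖ * r) * (‖b‖ * r) * (‖c‖ * ‖x - y‖) := norm_add₃_le.trans (by gcongr)
    _ = _ := by ring

/-- The average of a family of square-integrable functions. -/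
noncomputable def meanL (m d N : ℕ) : (Fin N → L2 m d) →L[ℂ] L2 m d :=
  (1 / (N : ℂ)) • ∑ k, ContinuousLinearMap.proj k

lemma meanL_apply (F : Fin N → L2 m d) : meanL m d N F = (1 / (N : ℂ)) • ∑ k, F k := by
  simp [meanL]

lemma continuous_meanState {Ψ : Fin N → Config m d → ℂ} (hΨ : ∀ j, Continuous (Ψ j)) :
    Continuous (meanState Ψ) :=
  continuous_const.mul (continuous_finsetSum _ fun k _ => hΨ k)

lemma toL2_meanState {Ψ : Fin N → Config m d → ℂ} (hΨ : ∀ j, Continuous (Ψ j)) :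
    toL2 (meanState Ψ) = meanL m d N fun k => toL2 (Ψ k) := by
  rw [meanL_apply, ← toL2_sum _ hΨ]
  exact toL2_const_mul (continuous_finsetSum _ fun k _ => hΨ k) _

lemma map_meanL (L : L2 m d →L[ℂ] L2 m d) (F : Fin N → L2 m d) :
    L (meanL m d N F) = meanL m d N fun k => L (F k) := by
  simp only [meanL_apply, map_smul, map_sum]

/-- Both models consist of such differences under a single integral, so this covers continuity and
the L² class for each of them. -/
lemma interaction_difference (i : Fin m → Fin 2) {f g h f' g' h' : Config m d → ℂ}
    (hf : Continuous f) (hg : Continuous g) (hh : Continuous h) (hf' : Continuous f')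
    (hg' : Continuous g') (hh' : Continuous h') :
    Continuous (fun x => ∫ y, (f (pick i x y) * conj (g y) * h (pick (fun n => 1 - i n) x y) -
      f' (pick i x y) * conj (g' y) * h' (pick (fun n => 1 - i n) x y))) ∧
    toL2 (fun x => ∫ y, (f (pick i x y) * conj (g y) * h (pick (fun n => 1 - i n) x y) -
      f' (pick i x y) * conj (g' y) * h' (pick (fun n => 1 - i n) x y))) =
      tripleProduct i (toL2 f) (toL2 g) (toL2 h) - tripleProduct i (toL2 f') (toL2 g') (toL2 h') := by
  have hc := continuous_integrand i hf hg hh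
  have hc' := continuous_integrand i hf' hg' hh'
  refine ⟨continuous_parametric_integral_torus (hc.sub hc'), ?_⟩
  have hint : ∀ {F : Config m d × Config m d → ℂ}, Continuous F → ∀ x,
      Integrable fun y => F (x, y) := fun {F} hF x =>
    (memLp_of_continuous (hF.comp (continuous_const.prodMk continuous_id))).integrable
      (by norm_num)
  have heq : (fun x => ∫ y, (f (pick i x y) * conj (g y) * h (pick (fun n => 1 - i n) x y) -
      f' (pick i x y) * conj (g' y) * h' (pick (fun n => 1 - i n) x y))) =
      fun x => (∫ y, f (pick i x y) * conj (g y) * h (pick (fun n => 1 - i n) x y)) +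
        (-1) * ∫ y, f' (pick i x y) * conj (g' y) * h' (pick (fun n => 1 - i n) x y) := by
    funext x
    rw [integral_sub (hint hc x) (hint hc' x)]
    ring
  have h1 := continuous_parametric_integral_torus hc
  have h2 := continuous_parametric_integral_torus hc'
  rw [heq]
  refine (toL2_add h1 (continuous_const.mul h2)).trans ?_
  rw [sub_eq_add_neg, ← toL2_tripleProduct i hf hg hh, ← toL2_tripleProduct i hf' hg' hh',
    ← neg_one_smul ℂ (toL2 fun x => ∫ y, f' (pick i x y) * conj (g' y) * _)]
  congr 1
  exact toL2_const_mul h2 _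

/-- `T` is a locally Lipschitz extension to `L²` of the interaction `R`, and it commutes with the
Schrödinger group of `V`. -/
structure IsEquivariantExtension (V : C(Config m d, ℝ))
    (R : (Fin N → Config m d → ℂ) → Fin N → Config m d → ℂ)
    (T : (Fin N → L2 m d) → Fin N → L2 m d) : Prop where
  continuous : ∀ Ψ, (∀ j, Continuous (Ψ j)) → ∀ j, Continuous (R Ψ j)
  toL2_eq : ∀ Ψ, (∀ j, Continuous (Ψ j)) → ∀ j, toL2 (R Ψ j) = T (fun k => toL2 (Ψ k)) j
  equivariant : ∀ t F j, torusGroup V t (T F j) = T (fun k => torusGroup V t (F k)) j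
  lipschitz : LipschitzOnBalls T

/-- The evaluation of a family at the index `j`. -/
noncomputable def evalL (m d : ℕ) {N : ℕ} (j : Fin N) : (Fin N → L2 m d) →L[ℂ] L2 m d :=
  ContinuousLinearMap.proj j

lemma evalL_apply (j : Fin N) (F : Fin N → L2 m d) : evalL m d j F = F j := rfl

lemma lipschitzOnBalls_left (i : Fin m → Fin 2) (j : Fin N) :
    LipschitzOnBalls fun F : Fin N → L2 m d => tripleProduct i (meanL m d N F) (F j) (F j) := by
  have h := lipschitzOnBalls_tripleProduct i (meanL m d N) (evalL m d j) (evalL m d j)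
  simpa only [evalL_apply] using h

lemma lipschitzOnBalls_middle (i : Fin m → Fin 2) (j : Fin N) :
    LipschitzOnBalls fun F : Fin N → L2 m d => tripleProduct i (F j) (meanL m d N F) (F j) := by
  have h := lipschitzOnBalls_tripleProduct i (evalL m d j) (meanL m d N) (evalL m d j)
  simpa only [evalL_apply] using h

lemma lipschitzOnBalls_right (i : Fin m → Fin 2) (j : Fin N) :
    LipschitzOnBalls fun F : Fin N → L2 m d => tripleProduct i (F j) (F j) (meanL m d N F) := by
  have h := lipschitzOnBalls_tripleProduct i (evalL m d j) (evalL m d j) (meanL m d N)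
  simpa only [evalL_apply] using h

/-- The tensor-model interaction on `L²`. -/
noncomputable def sltOp (κ : (Fin m → Fin 2) → ℝ) (F : Fin N → L2 m d) (j : Fin N) : L2 m d :=
  Complex.I • ∑ i, (κ i : ℂ) • (tripleProduct i (meanL m d N F) (F j) (F j) -
    tripleProduct i (F j) (meanL m d N F) (F j))

lemma isEquivariantExtension_slt {V : C(Config m d, ℝ)} (hV : ∀ i, ExchangeInvariant i V)
    (κ : (Fin m → Fin 2) → ℝ) :
    IsEquivariantExtension (N := N) V (sltInteraction κ) (sltOp κ) where
  continuous Ψ hΨ j := continuous_const.mul (continuous_finsetSum _ fun i _ =>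
    continuous_const.mul (interaction_difference i (continuous_meanState hΨ) (hΨ j) (hΨ j) (hΨ j)
      (continuous_meanState hΨ) (hΨ j)).1)
  toL2_eq Ψ hΨ j := by
    have h := fun i => interaction_difference i (continuous_meanState hΨ) (hΨ j) (hΨ j) (hΨ j)
      (continuous_meanState hΨ) (hΨ j)
    have hterm := fun i => (continuous_const (y := (κ i : ℂ))).mul (h i).1
    refine (toL2_const_mul (continuous_finsetSum _ fun i _ => hterm i) _).trans ?_
    rw [toL2_sum _ hterm, sltOp, ← toL2_meanState hΨ]
    congr 1
    exact Finset.sum_congr rfl fun i _ => (toL2_const_mul (h i).1 _).trans (by rw [(h i).2])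
  equivariant t F j := by
    simp only [sltOp, map_smul, map_sum, map_sub, torusGroup_tripleProduct (hV _), map_meanL]
  lipschitz := LipschitzOnBalls.pi fun j => LipschitzOnBalls.const_smul (LipschitzOnBalls.sum
    (fun i => ((lipschitzOnBalls_left i j).sub (lipschitzOnBalls_middle i j)).const_smul _) _) _

/-- The matrix-model interaction on `L²`. -/
noncomputable def slmOp (κ₀ κ₁ : ℝ) (F : Fin N → L2 2 d) (j : Fin N) : L2 2 d :=
  (Complex.I * (κ₀ : ℂ)) • (tripleProduct ![0, 1] (meanL 2 d N F) (F j) (F j) -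
    tripleProduct ![0, 1] (F j) (meanL 2 d N F) (F j)) +
  (Complex.I * (κ₁ : ℂ)) • (tripleProduct ![0, 1] (F j) (F j) (meanL 2 d N F) -
    tripleProduct ![0, 1] (F j) (meanL 2 d N F) (F j))

lemma pick_zero_one (x y : Config 2 d) : pick ![0, 1] x y = ![x 0, y 1] := by
  funext n; fin_cases n <;> simp [pick]

lemma pick_one_zero (x y : Config 2 d) :
    pick (fun n => 1 - (![0, 1] : Fin 2 → Fin 2) n) x y = ![y 0, x 1] := by
  funext n; fin_cases n <;> simp [pick]

/-- The matrix model uses only the multi-index (0, 1). Its κ₁ term has the mean in the third slot,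
which the tensor model writes in the first. -/
lemma isEquivariantExtension_slm {V : C(Config 2 d, ℝ)} (hV : ExchangeInvariant ![0, 1] V)
    (κ₀ κ₁ : ℝ) : IsEquivariantExtension (N := N) V (slmInteraction κ₀ κ₁) (slmOp κ₀ κ₁) := by
  have h₀ : ∀ {Ψ : Fin N → Config 2 d → ℂ}, (∀ j, Continuous (Ψ j)) → ∀ j, _ := fun hΨ j =>
    interaction_difference ![0, 1] (continuous_meanState hΨ) (hΨ j) (hΨ j) (hΨ j)
      (continuous_meanState hΨ) (hΨ j)
  have h₁ : ∀ {Ψ : Fin N → Config 2 d → ℂ}, (∀ j, Continuous (Ψ j)) → ∀ j, _ := fun hΨ j =>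
    interaction_difference ![0, 1] (hΨ j) (hΨ j) (continuous_meanState hΨ) (hΨ j)
      (continuous_meanState hΨ) (hΨ j)
  simp only [pick_zero_one, pick_one_zero] at h₀ h₁
  refine ⟨fun Ψ hΨ j => ?_, fun Ψ hΨ j => ?_, fun t F j => ?_, ?_⟩
  · exact (continuous_const.mul (h₀ hΨ j).1).add (continuous_const.mul (h₁ hΨ j).1)
  · refine (toL2_add (continuous_const.mul (h₀ hΨ j).1)
      (continuous_const.mul (h₁ hΨ j).1)).trans ?_
    rw [slmOp, ← toL2_meanState hΨ, ← (h₀ hΨ j).2, ← (h₁ hΨ j).2]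
    exact congrArg₂ (· + ·) (toL2_const_mul (h₀ hΨ j).1 _) (toL2_const_mul (h₁ hΨ j).1 _)
  · simp only [slmOp, map_smul, map_add, map_sub, torusGroup_tripleProduct hV, map_meanL]
  · exact LipschitzOnBalls.pi fun j =>
      (((lipschitzOnBalls_left _ j).sub (lipschitzOnBalls_middle _ j)).const_smul _).add
        (((lipschitzOnBalls_right _ j).sub (lipschitzOnBalls_middle _ j)).const_smul _)

end Interactions

/-! ### Conjugation of the two dynamics -/

section Conjugation

variable {m d N : ℕ}

lemma continuous_hamiltonian (V : C(Config m d, ℝ)) {f : Config m d → ℂ} (hf : IsC2 f) :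
    Continuous (hamiltonian V f) :=
  (continuous_kineticTerm hf).add
    ((Complex.continuous_ofReal.comp V.continuous).mul hf.continuous)

variable {A : (Config m d → ℂ) → Config m d → ℂ}
  {R : (Fin N → Config m d → ℂ) → Fin N → Config m d → ℂ} {Ψin : Fin N → Config m d → ℂ}
  {Ψ : Fin N → ℝ → Config m d → ℂ}

lemma IsGlobalSolution.hasDerivAt_toL2 (hΨ : IsGlobalSolution A R Ψin Ψ)
    (hR : ∀ Φ, (∀ j, Continuous (Φ j)) → ∀ j, Continuous (R Φ j))
    (hA : ∀ f, IsC2 f → Continuous (A f)) (j : Fin N) {t : ℝ} (ht : 0 < t) :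
    HasDerivAt (fun s => toL2 (Ψ j s))
      (-Complex.I • (toL2 (A (Ψ j t)) + toL2 (R (fun k => Ψ k t) j))) t := by
  have hc : ∀ j, ∀ s ∈ Set.Ioi (0 : ℝ), Continuous (Ψ j s) := fun j s hs =>
    (hΨ.space j s hs).continuous
  refine (_root_.hasDerivAt_toL2 (f' := fun t x => deriv (fun s => Ψ j s x) t) isOpen_Ioi (hc j)
    (hΨ.continuousOn_deriv j) (fun s hs x => (hΨ.differentiableAt j s hs x).hasDerivAt)
    ht).congr_deriv ?_
  have hA' := hA _ (hΨ.space j t ht)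
  have hR' := hR (fun k => Ψ k t) (fun k => hc k t ht) j
  rw [← toL2_add hA' hR']
  refine Eq.trans (congrArg toL2 ?_) (toL2_const_mul (hA'.add hR') _)
  funext x
  have h := hΨ.equation j t ht x
  change _ = -Complex.I * (A (Ψ j t) x + R (fun k => Ψ k t) j x)
  linear_combination (-Complex.I) * h + deriv (fun s => Ψ j s x) t * Complex.I_sq

/-- The Schrödinger group conjugates the interacting dynamics to the purely nonlinear one. -/
lemma toL2_eq_torusGroup {V : C(Config m d, ℝ)} {T : (Fin N → L2 m d) → Fin N → L2 m d}
    (hT : IsEquivariantExtension V R T) {φ : Fin N → ℝ → Config m d → ℂ}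
    (hΨ : IsGlobalSolution (hamiltonian V) R Ψin Ψ) (hφ : IsGlobalSolution 0 R Ψin φ)
    (j : Fin N) {t : ℝ} (ht : 0 ≤ t) : toL2 (Ψ j t) = torusGroup V t (toL2 (φ j t)) := by
  have hU := isSchrodingerGroup_torusGroup V
  have hbound : ∀ (s : ℝ) (x : L2 m d), ‖torusGroup V (-s) x‖ ≤ 1 * ‖x‖ := fun s x => by
    rw [hU.norm_map, one_mul]
  have hcont : ∀ x : L2 m d, Continuous fun s => torusGroup V (-s) x := fun x =>
    (hU.continuous x).comp continuous_neg
  have hT' : LipschitzOnBalls fun (F : Fin N → L2 m d) j => -Complex.I • T F j :=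
    hT.lipschitz.const_smul (-Complex.I)
  -- At positive times Ψ(s) is C², so U(-r) Ψ(s) is differentiable in r. Its derivative at r = s
  -- contributes +iH, cancelling the linear term of the equation, and equivariance carries U(-s)
  -- inside T.
  have hw' : ∀ s, 0 < s → HasDerivAt (fun s j => torusGroup V (-s) (toL2 (Ψ j s)))
      (fun j => -Complex.I • T (fun k => torusGroup V (-s) (toL2 (Ψ k s))) j) s := by
    intro s hs
    refine hasDerivAt_pi.2 fun j => ?_
    refine (hasDerivAt_clm_apply_of_bound (L := fun s => torusGroup V (-s)) hbound
      (hcont _).continuousAt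
      (hΨ.hasDerivAt_toL2 hT.continuous (fun f hf => continuous_hamiltonian V hf) j hs)
      (hasDerivAt_group_neg hU.add (hU.generator _ (hΨ.space j s hs)) s)).congr_deriv ?_
    rw [hT.toL2_eq _ (fun k => (hΨ.space k s hs).continuous), ← hT.equivariant]
    simp only [map_smul, map_add, smul_add]
    simp
  have hv' : ∀ s, 0 < s → HasDerivAt (fun s j => (toL2 (φ j s) : L2 m d))
      (fun j => -Complex.I • T (fun k => toL2 (φ k s)) j) s := by
    intro s hs
    refine hasDerivAt_pi.2 fun j => ?_
    refine (hφ.hasDerivAt_toL2 hT.continuous (fun _ _ => continuous_const) j hs).congr_deriv ?_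
    rw [hT.toL2_eq _ (fun k => (hφ.space k s hs).continuous)]
    have h0 : (toL2 ((0 : (Config m d → ℂ) → Config m d → ℂ) (φ j s)) : L2 m d) = 0 :=
      toL2_zero
    rw [h0, zero_add]
  have h := hT'.ode_unique (w := fun s j => torusGroup V (-s) (toL2 (Ψ j s)))
    (v := fun s j => toL2 (φ j s))
    (continuousOn_pi.2 fun j s hs => tendsto_clm_apply_of_bound hbound
      (continuousOn_toL2 (hΨ.continuousOn j) s hs) (hcont _).continuousWithinAt)
    (continuousOn_pi.2 fun j => continuousOn_toL2 (hφ.continuousOn j)) hw' hv'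
    (by
      funext j
      have h1 : Ψ j 0 = φ j 0 := funext fun x => by rw [hΨ.initial, hφ.initial]
      rw [neg_zero, hU.zero, h1]; rfl) ht
  -- Uniqueness gave U(-t) Ψ(t) = φ(t); applying U(t) inverts this.
  rw [← congrFun h j, ← ContinuousLinearMap.comp_apply, ← hU.add, add_neg_cancel, hU.zero]
  rfl

/-- In each component n the exchange at most swaps the two summands W n (x n) and W n (y n). -/
lemma exchangeInvariant_of_additive {V : Config m d → ℝ}
    (hV : ∃ W : Fin m → Torus d → ℝ, ∀ x, V x = ∑ n, W n (x n)) (i : Fin m → Fin 2) :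
    ExchangeInvariant i V := by
  obtain ⟨W, hW⟩ := hV
  intro x y
  simp only [hW, ← Finset.sum_add_distrib]
  refine Finset.sum_congr rfl fun n _ => ?_
  simp only [pick, one_sub_eq_zero_iff]
  by_cases h : i n = 0
  · simp [h]
  · simp [h, add_comm]

end Conjugation

theorem proposition5p2 (d : ℕ) :
    -- the group `e^{-iHt}` is well defined
    (∀ (m : ℕ) (V : Config m d → ℝ), Continuous V →
      ∃! U : ℝ → L2 m d →L[ℂ] L2 m d, IsSchrodingerGroup V U) ∧
    -- the Schrödinger–Lohe tensor model
    (∀ (m N : ℕ) (V : Config m d → ℝ), Continuous V →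
      (∃ W : Fin m → Torus d → ℝ, ∀ x, V x = ∑ n, W n (x n)) →
      ∀ (κ : (Fin m → Fin 2) → ℝ) (Ψin : Fin N → Config m d → ℂ)
        (Ψ φ : Fin N → ℝ → Config m d → ℂ),
        IsGlobalSolution (hamiltonian V) (sltInteraction κ) Ψin Ψ →
        IsGlobalSolution 0 (sltInteraction κ) Ψin φ →
        ∀ (j : Fin N) (t : ℝ), 0 ≤ t →
          toL2 (Ψ j t) = schrodingerGroup V t (toL2 (φ j t))) ∧
    -- the Schrödinger–Lohe matrix model
    (∀ (N : ℕ) (V : Config 2 d → ℝ), Continuous V →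
      (∃ V₁ V₂ : Torus d → ℝ, ∀ x, V x = V₁ (x 0) + V₂ (x 1)) →
      ∀ (κ₀ κ₁ : ℝ) (Ψin : Fin N → Config 2 d → ℂ)
        (Ψ φ : Fin N → ℝ → Config 2 d → ℂ),
        IsGlobalSolution (hamiltonian V) (slmInteraction κ₀ κ₁) Ψin Ψ →
        IsGlobalSolution 0 (slmInteraction κ₀ κ₁) Ψin φ →
        ∀ (j : Fin N) (t : ℝ), 0 ≤ t →
          toL2 (Ψ j t) = schrodingerGroup V t (toL2 (φ j t))) := by
  refine ⟨fun m V hV => ?_, fun m N V hV hadd κ Ψin Ψ φ hΨ hφ j t ht => ?_,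
    fun N V hV hadd κ₀ κ₁ Ψin Ψ φ hΨ hφ j t ht => ?_⟩
  · exact ⟨_, isSchrodingerGroup_torusGroup ⟨V, hV⟩,
      fun U hU => IsSchrodingerGroup.eq_torusGroup (V := ⟨V, hV⟩) hU⟩
  · rw [show schrodingerGroup V = _ from schrodingerGroup_eq ⟨V, hV⟩]
    exact toL2_eq_torusGroup (V := ⟨V, hV⟩)
      (isEquivariantExtension_slt (exchangeInvariant_of_additive hadd) κ) hΨ hφ j ht
  · obtain ⟨V₁, V₂, hW⟩ := hadd
    have hex : ExchangeInvariant ![0, 1] V :=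
      exchangeInvariant_of_additive ⟨![V₁, V₂], fun x => by simp [hW, Fin.sum_univ_two]⟩ _
    rw [show schrodingerGroup V = _ from schrodingerGroup_eq ⟨V, hV⟩]
    exact toL2_eq_torusGroup (V := ⟨V, hV⟩) (isEquivariantExtension_slm hex κ₀ κ₁) hΨ hφ j ht
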